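/- For a real symmetric $n\times n$ matrix $A$ let $\mathrm{In}(A)=(\pi(A),\zeta(A),\nu(A))$, where $\pi(A)$, $\zeta(A)$ and $\nu(A)$ are the numbers of positive, zero and negative eigenvalues of $A$, counted with multiplicity. Let $0<p_1<p_2<\cdots<p_n$ and let $r>0$ be real. Let $L_r=\left[\frac{p_i^r-p_j^r}{p_i-p_j}\right]_{i,j=1}^n$, where the diagonal entries are understood as the derivatives $r\,p_i^{\,r-1}$. Then: (i) $L_r$ is singular if and only if $r\in\{1,2,\ldots,n-1\}$. (ii) At the integers $r\in\{1,2,\ldots,n\}$: if $r=2k$, then $\mathrm{In}(L_r)=(k,\,n-r,\,k)$; if $r=2k-1$, then $\mathrm{In}(L_r)=(k,\,n-r,\,k-1)$. (iii) If $0<r<n$ and $r$ is not an integer, then $\mathrm{In}(L_r)=(n-k,\,0,\,k)$ when $\lfloor r\rfloor=2k$, and $\mathrm{In}(L_r)=(k,\,0,\,n-k)$ when $\lfloor r\rfloor=2k-1$. (iv) If $r>n-1$, then $\mathrm{In}(L_r)=\mathrm{In}(L_n)$. (v) Every nonzero eigenvalue of $L_r$ is simple. -/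

import Mathlib

/-- The Loewner matrix `L_f(p₁, …, pₙ)` of a function `f` at the points `p₁, …, pₙ`: the entry
`(i, j)` is the difference quotient of `f` at `p i`, `p j`, read on the diagonal as `f' (p i)`. -/
noncomputable def loewnerMatrix {n : ℕ} (f : ℝ → ℝ) (p : Fin n → ℝ) :
    Matrix (Fin n) (Fin n) ℝ :=
  Matrix.of fun i j =>
    if i = j then deriv f (p i) else (f (p i) - f (p j)) / (p i - p j)

/-- The Loewner matrix `L_r` of the power function `t ↦ t ^ r`. -/
noncomputable def powerLoewner {n : ℕ} (p : Fin n → ℝ) (r : ℝ) : Matrix (Fin n) (Fin n) ℝ :=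
  loewnerMatrix (fun t : ℝ => t ^ r) p

theorem loewnerMatrix_isHermitian {n : ℕ} (f : ℝ → ℝ) (p : Fin n → ℝ) :
    (loewnerMatrix f p).IsHermitian := by
  ext i j
  simp only [Matrix.conjTranspose_apply, loewnerMatrix, Matrix.of_apply, star_trivial]
  by_cases h : i = j
  · subst h; rfl
  · rw [if_neg h, if_neg (Ne.symm h), ← neg_sub (f (p i)), ← neg_sub (p i), neg_div_neg_eq]

theorem powerLoewner_isHermitian {n : ℕ} (p : Fin n → ℝ) (r : ℝ) :
    (powerLoewner p r).IsHermitian :=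
  loewnerMatrix_isHermitian _ p

/-- The inertia of a Hermitian matrix: the numbers of its positive, zero and negative
eigenvalues (in this order), counted with multiplicity. -/
noncomputable def hermitianInertia {n : ℕ} {A : Matrix (Fin n) (Fin n) ℝ}
    (hA : A.IsHermitian) : ℕ × ℕ × ℕ :=
  ((Finset.univ.filter fun i => 0 < hA.eigenvalues i).card,
   (Finset.univ.filter fun i => hA.eigenvalues i = 0).card,
   (Finset.univ.filter fun i => hA.eigenvalues i < 0).card)

/-- The inertia of `L_r`. -/
noncomputable def loewnerInertia {n : ℕ} (p : Fin n → ℝ) (r : ℝ) : ℕ × ℕ × ℕ :=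
  hermitianInertia (powerLoewner_isHermitian p r)

/-!
Everything about `L_r` is read off from one count of zeros. By Rolle, a sum of `N` real powers of `t`
with different exponents has fewer than `N` positive zeros with multiplicity, unless all its
coefficients vanish. Let `K(t, q) = (t ^ r - q ^ r) / (t - q)`, with `r t ^ (r - 1)` on the diagonal.
Multiplied by `∏ (t - qⱼ)`, a combination of `K(t, q₁), …, K(t, q_m)` is a sum of powers with
exponents `0, …, m - 1, r, …, r + m - 1`, so the minors of `K` of size `m` do not vanish unless `r`
is one of `1, …, m - 1` (`det_powSlope_ne_zero`); in particular `det L_r ≠ 0` for all other `r`.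
At an integer `r = m < n` the matrix `L_r` has rank at most `m`.

For the inertia, lower bounds on the numbers of positive, zero and negative eigenvalues are proved
that add up to `n`. For `0 < r < 1` an integral formula makes `L_r` positive definite, hence
`L_{-r}` is negative definite; and since `L_{r + 2} = D L_r D + u eᵀ + e uᵀ` with
`D = diag(pᵢ)`, the form of `L_{r + 2k}` is definite on a subspace of codimension `k`
(`loewnerForm_definite_on`). Applied to the first `m` of the points and an exponent between
`m - 1` and `m`, this gives the other bounds: along `r > m - 1` the matrix at `m` points stays nonsingular,
so its inertia is constant, and passing to a principal submatrix only loses eigenvalues of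
each sign (`le_signCount_one`, `le_signCount_neg_one`).

For simplicity, minors of `K` of a given size at increasing points have a common strict sign
(`det_powSlope_mul_det_powSlope_pos`), so `K` diminishes variation: `∑ xⱼ K(t, pⱼ)` has at most as
many zeros as `x` has sign changes. Hence an eigenvector with nonzero eigenvalue has a nonzero first
entry (`eq_zero_of_mulVec_eq_smul`), and no eigenspace but the kernel can have dimension two.
-/

/-! ### Zeros of real-exponent polynomials -/

/-- Rolle's theorem for a finite set of zeros: between neighbouring zeros of `f` lie zeros of `f'`,
all different from the given ones. -/
theorem exists_finset_zeros_of_hasDerivAt {f f' : ℝ → ℝ} {T : Finset ℝ} (hT : ∀ t ∈ T, 0 < t)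
    (hf : ∀ t, 0 < t → HasDerivAt f (f' t) t) (h0 : ∀ t ∈ T, f t = 0) :
    ∃ T' : Finset ℝ, (∀ t ∈ T', 0 < t) ∧ (∀ t ∈ T', f' t = 0) ∧ Disjoint T T' ∧
      T.card ≤ T'.card + 1 := by
  have key : ∀ x y, ∃ z, x ∈ T → y ∈ T → x < y → (x < z ∧ z < y) ∧ f' z = 0 := by
    intro x y
    by_cases h : x ∈ T ∧ y ∈ T ∧ x < y
    · obtain ⟨hx, hy, hxy⟩ := h
      obtain ⟨z, hz, hz'⟩ := exists_hasDerivAt_eq_zero (f := f) (f' := f') hxy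
        (fun t ht => (hf t ((hT x hx).trans_le ht.1)).continuousAt.continuousWithinAt)
        (by rw [h0 x hx, h0 y hy]) (fun t ht => hf t ((hT x hx).trans ht.1))
      exact ⟨z, fun _ _ _ => ⟨hz, hz'⟩⟩
    · exact ⟨0, fun hx hy hxy => absurd ⟨hx, hy, hxy⟩ h⟩
  choose z hz using key
  let t : Finset ℝ := ((T ×ˢ T).filter fun q => q.1 < q.2).image fun q => z q.1 q.2
  have ht : ∀ w ∈ t, 0 < w ∧ f' w = 0 := by
    intro w hw
    obtain ⟨q, hq, rfl⟩ := Finset.mem_image.1 hw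
    obtain ⟨hq1, hq2⟩ := Finset.mem_filter.1 hq
    obtain ⟨hq3, hq4⟩ := Finset.mem_product.1 hq1
    obtain ⟨h1, h2⟩ := hz q.1 q.2 hq3 hq4 hq2
    exact ⟨(hT _ hq3).trans h1.1, h2⟩
  refine ⟨t \ T, fun w hw => (ht w (Finset.mem_sdiff.1 hw).1).1,
    fun w hw => (ht w (Finset.mem_sdiff.1 hw).1).2, Finset.disjoint_sdiff, ?_⟩
  refine Finset.card_le_sdiff_of_interleaved fun x hx y hy hxy _ => ?_
  exact ⟨z x y, Finset.mem_image.2 ⟨(x, y), Finset.mem_filter.2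
    ⟨Finset.mem_product.2 ⟨hx, hy⟩, hxy⟩, rfl⟩, (hz x y hx hy hxy).1⟩

theorem hasDerivAt_sum_rpow {ι : Type*} (α a : ι → ℝ) (s : Finset ι) {t : ℝ} (ht : 0 < t) :
    HasDerivAt (fun t : ℝ => ∑ i ∈ s, a i * t ^ α i) (∑ i ∈ s, a i * (α i * t ^ (α i - 1))) t := by
  refine HasDerivAt.fun_sum fun i _ => ?_
  exact (Real.hasDerivAt_rpow_const (Or.inl ht.ne')).const_mul (a i)

theorem sum_rpow_sub {ι : Type*} (α a : ι → ℝ) (s : Finset ι) (b : ℝ) {t : ℝ} (ht : 0 < t) :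
    ∑ i ∈ s, a i * t ^ (α i - b) = t ^ (-b) * ∑ i ∈ s, a i * t ^ α i := by
  rw [Finset.mul_sum]
  refine Finset.sum_congr rfl fun i _ => ?_
  rw [sub_eq_add_neg, Real.rpow_add ht]; ring

/-- One step of the zero count: dividing by `t ^ α j` and differentiating removes the term `j`. -/
theorem sum_erase_rpow_eq_zero {ι : Type*} [DecidableEq ι] (α a : ι → ℝ) (s : Finset ι) (j : ι)
    {t : ℝ} (ht : 0 < t)
    (h : ∑ i ∈ s, a i * ((α i - α j) * t ^ (α i - α j - 1)) = 0) :
    ∑ i ∈ s.erase j, (a i * (α i - α j)) * t ^ α i = 0 := by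
  have h1 : ∑ i ∈ s, (a i * (α i - α j)) * t ^ (α i - (α j + 1)) = 0 := by
    rw [← h]
    refine Finset.sum_congr rfl fun i _ => ?_
    rw [sub_sub]; ring
  rw [sum_rpow_sub _ _ _ _ ht, mul_eq_zero] at h1
  have h2 := h1.resolve_left (Real.rpow_pos_of_pos ht _).ne'
  rw [← h2]
  refine Finset.sum_erase _ ?_
  simp

/-- A sum of `N` real powers with different exponents that has `N` positive zeros vanishes
identically. -/
theorem coeff_eq_zero_of_zeros {ι : Type*} [DecidableEq ι] (α : ι → ℝ)
    (hα : Function.Injective α) (s : Finset ι) :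
    ∀ (a : ι → ℝ) (T : Finset ℝ), (∀ t ∈ T, 0 < t) → s.card ≤ T.card →
      (∀ t ∈ T, ∑ i ∈ s, a i * t ^ α i = 0) → ∀ i ∈ s, a i = 0 := by
  induction s using Finset.induction_on with
  | empty => simp
  | insert j s hj ih =>
    intro a T hT hcard h0
    obtain ⟨T', hT', hz, -, hc⟩ := exists_finset_zeros_of_hasDerivAt (T := T)
      (f := fun t => ∑ i ∈ insert j s, a i * t ^ (α i - α j)) hT
      (fun t ht => hasDerivAt_sum_rpow (fun i => α i - α j) a _ ht)
      (fun t ht => by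
        show ∑ i ∈ insert j s, a i * t ^ (α i - α j) = 0
        rw [sum_rpow_sub _ _ _ _ (hT t ht), h0 t ht, mul_zero])
    rw [Finset.card_insert_of_notMem hj] at hcard
    have hs : ∀ i ∈ s, a i = 0 := by
      intro i hi
      have := ih (fun i => a i * (α i - α j)) T' hT' (by omega) (fun t ht => by
        have := sum_erase_rpow_eq_zero α a (insert j s) j (hT' t ht) (hz t ht)
        rwa [Finset.erase_insert hj] at this) i hi
      refine (mul_eq_zero.1 this).resolve_right (sub_ne_zero.2 fun h => hj ?_)
      exact hα h ▸ hi
    have hj0 : a j = 0 := by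
      obtain ⟨t, ht⟩ : T.Nonempty := Finset.card_pos.1 (by omega)
      have := h0 t ht
      rw [Finset.sum_insert hj, Finset.sum_eq_zero (fun i hi => by rw [hs i hi, zero_mul]),
        add_zero, mul_eq_zero] at this
      exact this.resolve_right (Real.rpow_pos_of_pos (hT t ht) _).ne'
    intro i hi
    rcases Finset.mem_insert.1 hi with rfl | hi
    exacts [hj0, hs i hi]

/-- The zero count with multiplicities up to two: `D` consists of double zeros. -/
theorem coeff_eq_zero_of_double_zeros {ι : Type*} [Fintype ι] [DecidableEq ι] (α : ι → ℝ)
    (hα : Function.Injective α) (a : ι → ℝ) (T D : Finset ℝ) (hT : ∀ t ∈ T, 0 < t) (hD : D ⊆ T)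
    (hcard : Fintype.card ι ≤ T.card + D.card) (h0 : ∀ t ∈ T, ∑ i, a i * t ^ α i = 0)
    (h1 : ∀ t ∈ D, ∑ i, a i * (α i * t ^ (α i - 1)) = 0) : a = 0 := by
  cases isEmpty_or_nonempty ι with
  | inl h => exact Subsingleton.elim _ _
  | inr h =>
  obtain ⟨j⟩ := h
  have hι : 0 < Fintype.card ι := Fintype.card_pos_iff.2 ⟨j⟩
  have hDT := Finset.card_le_card hD
  obtain ⟨T', hT', hz, hdisj, hc⟩ := exists_finset_zeros_of_hasDerivAt (T := T)
    (f := fun t => ∑ i, a i * t ^ (α i - α j)) hT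
    (fun t ht => hasDerivAt_sum_rpow (fun i => α i - α j) a _ ht)
    (fun t ht => by
      show ∑ i, a i * t ^ (α i - α j) = 0
      rw [sum_rpow_sub _ _ _ _ (hT t ht), h0 t ht, mul_zero])
  have hcard' : (T' ∪ D).card = T'.card + D.card :=
    Finset.card_union_of_disjoint
      (Finset.disjoint_of_subset_left hD hdisj |>.symm)
  have hne : ∀ i, i ≠ j → a i = 0 := by
    intro i hi
    have := coeff_eq_zero_of_zeros α hα (Finset.univ.erase j) (fun i => a i * (α i - α j)) (T' ∪ D)
      (fun t ht => (Finset.mem_union.1 ht).elim (hT' t) (fun h => hT t (hD h)))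
      (by rw [Finset.card_erase_of_mem (Finset.mem_univ _), Finset.card_univ]; omega)
      (fun t ht => by
        rcases Finset.mem_union.1 ht with ht | ht
        · exact sum_erase_rpow_eq_zero α a _ j (hT' t ht) (hz t ht)
        · have htp := hT t (hD ht)
          refine sum_erase_rpow_eq_zero α a _ j htp ?_
          -- at a double zero the product rule for `t ^ (-α j) * f t` leaves nothing
          have e1 := sum_rpow_sub α (fun i => a i * α i) Finset.univ (α j + 1) htp
          have e2 := sum_rpow_sub α a Finset.univ (α j + 1) htp
          have e3 := sum_rpow_sub α (fun i => a i * α i) Finset.univ 1 htp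
          have e4 : ∑ i, a i * α i * t ^ (α i - 1) = 0 := by
            rw [← h1 t ht]; exact Finset.sum_congr rfl fun i _ => by ring
          rw [e4, zero_eq_mul] at e3
          rw [e3.resolve_left (Real.rpow_pos_of_pos htp _).ne', mul_zero] at e1
          rw [h0 t (hD ht), mul_zero] at e2
          have : ∑ i, a i * ((α i - α j) * t ^ (α i - α j - 1)) =
              ∑ i, a i * α i * t ^ (α i - (α j + 1))
                - α j * ∑ i, a i * t ^ (α i - (α j + 1)) := by
            rw [Finset.mul_sum, ← Finset.sum_sub_distrib]
            refine Finset.sum_congr rfl fun i _ => ?_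
            rw [sub_sub]; ring
          rw [this, e1, e2]; simp) i (by simp [hi])
    exact (mul_eq_zero.1 this).resolve_right (sub_ne_zero.2 fun h => hi (hα h))
  funext i
  by_cases hi : i = j
  · subst hi
    obtain ⟨t, ht⟩ : T.Nonempty := Finset.card_pos.1 (by omega)
    have := h0 t ht
    rw [Finset.sum_eq_single i (fun k _ hk => by rw [hne k hk, zero_mul]) (by simp),
      mul_eq_zero] at this
    exact this.resolve_right (Real.rpow_pos_of_pos (hT t ht) _).ne'
  · exact hne i hi

/-! ### The difference quotient of the power function -/

/-- The kernel `(t ^ r - q ^ r) / (t - q)`, extended to the diagonal by the derivative. -/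
noncomputable def powSlope (r t q : ℝ) : ℝ :=
  if t = q then r * t ^ (r - 1) else (t ^ r - q ^ r) / (t - q)

theorem powSlope_self (r t : ℝ) : powSlope r t t = r * t ^ (r - 1) := if_pos rfl

theorem powSlope_of_ne (r : ℝ) {t q : ℝ} (h : t ≠ q) :
    powSlope r t q = (t ^ r - q ^ r) / (t - q) := if_neg h

theorem powSlope_mul_sub (r t q : ℝ) : powSlope r t q * (t - q) = t ^ r - q ^ r := by
  by_cases h : t = q
  · simp [h]
  · rw [powSlope_of_ne r h, div_mul_cancel₀ _ (sub_ne_zero.2 h)]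

theorem powSlope_comm (r t q : ℝ) : powSlope r t q = powSlope r q t := by
  by_cases h : t = q
  · rw [h]
  · rw [powSlope_of_ne r h, powSlope_of_ne r (Ne.symm h), ← neg_sub (t ^ r), ← neg_sub t,
      neg_div_neg_eq]

theorem powerLoewner_apply {n : ℕ} {p : Fin n → ℝ} (hpos : ∀ i, 0 < p i)
    (hp : Function.Injective p) (r : ℝ) (i j : Fin n) :
    powerLoewner p r i j = powSlope r (p i) (p j) := by
  simp only [powerLoewner, loewnerMatrix, Matrix.of_apply]
  by_cases h : i = j
  · subst h
    rw [if_pos rfl, powSlope_self]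
    exact (Real.hasDerivAt_rpow_const (Or.inl (hpos i).ne')).deriv
  · rw [if_neg h, powSlope_of_ne r (fun e => h (hp e))]

/-- Joint continuity; at a diagonal point this is strict differentiability of `t ↦ t ^ r`. -/
theorem continuousAt_powSlope (r : ℝ) {z : ℝ × ℝ} (h1 : 0 < z.1) (h2 : 0 < z.2) :
    ContinuousAt (fun z : ℝ × ℝ => powSlope r z.1 z.2) z := by
  obtain ⟨a, b⟩ := z
  simp only at h1 h2
  by_cases hab : a = b
  · subst hab
    have hs : HasStrictDerivAt (fun t : ℝ => t ^ r) (r * a ^ (r - 1)) a :=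
      Real.hasStrictDerivAt_rpow_const_of_ne h1.ne' r
    have hc : ContinuousAt (fun z : ℝ × ℝ => r * z.1 ^ (r - 1)) (a, a) :=
      continuousAt_const.mul (continuousAt_fst.rpow_const (Or.inl h1.ne'))
    rw [Metric.continuousAt_iff']
    intro ε hε
    have e1 := hs.hasStrictFDerivAt.isLittleO.bound (half_pos hε)
    have e2 := (Metric.continuousAt_iff'.1 hc) ε hε
    filter_upwards [e1, e2] with z hz1 hz2
    simp only [powSlope_self]
    by_cases hz : z.1 = z.2
    · rw [← hz, powSlope_self]; exact hz2
    · have hne : 0 < ‖z.1 - z.2‖ := norm_pos_iff.2 (sub_ne_zero.2 hz)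
      have hd : powSlope r z.1 z.2 - r * a ^ (r - 1) =
          (z.1 ^ r - z.2 ^ r - (z.1 - z.2) • (r * a ^ (r - 1))) / (z.1 - z.2) := by
        rw [powSlope_of_ne r hz, smul_eq_mul]
        field_simp [sub_ne_zero.2 hz]
      rw [dist_eq_norm, hd, norm_div, div_lt_iff₀ hne]
      refine (show ‖z.1 ^ r - z.2 ^ r - (z.1 - z.2) • (r * a ^ (r - 1))‖ ≤ _ from hz1).trans_lt ?_
      exact mul_lt_mul_of_pos_right (half_lt_self hε) hne
  · have hc : ContinuousAt (fun z : ℝ × ℝ => (z.1 ^ r - z.2 ^ r) / (z.1 - z.2)) (a, b) :=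
      ((continuousAt_fst.rpow_const (Or.inl h1.ne')).sub
        (continuousAt_snd.rpow_const (Or.inl h2.ne'))).div
        (continuousAt_fst.sub continuousAt_snd) (sub_ne_zero.2 hab)
    refine hc.congr ?_
    have : ∀ᶠ z : ℝ × ℝ in nhds (a, b), z.1 ≠ z.2 :=
      (isOpen_ne_fun continuous_fst continuous_snd).mem_nhds hab
    filter_upwards [this] with z hz
    rw [powSlope_of_ne r hz]

theorem continuousAt_powSlope_left (r : ℝ) {t q : ℝ} (ht : 0 < t) (hq : 0 < q) :
    ContinuousAt (fun t => powSlope r t q) t :=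
  (continuousAt_powSlope r (z := (t, q)) ht hq).comp
    (f := fun t : ℝ => (t, q)) (continuousAt_id.prodMk continuousAt_const)

/-! ### Minors of the kernel -/

theorem hasDerivAt_mul_of_eq_zero {P φ : ℝ → ℝ} {P' t : ℝ} (hP : HasDerivAt P P' t)
    (hPt : P t = 0) (hφ : ContinuousAt φ t) (hφt : φ t = 0) :
    HasDerivAt (fun s => P s * φ s) 0 t := by
  rw [hasDerivAt_iff_tendsto_slope] at hP ⊢
  have h : Filter.Tendsto (fun s => slope P t s * φ s) (nhdsWithin t {t}ᶜ) (nhds (P' * φ t)) :=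
    hP.mul (hφ.tendsto.mono_left nhdsWithin_le_nhds)
  rw [hφt, mul_zero] at h
  refine h.congr fun s => ?_
  simp only [slope_def_field, hPt, zero_mul, sub_zero]
  ring

theorem eval_eq_sum_fin {m : ℕ} {A : Polynomial ℝ} (hA : A.natDegree < m) (t : ℝ) :
    A.eval t = ∑ k : Fin m, A.coeff k * t ^ ((k : ℕ) : ℝ) := by
  rw [Polynomial.eval_eq_sum_range' hA, Finset.sum_range]
  simp only [Real.rpow_natCast]

/-- The columns of a minor `[K(tᵢ, qⱼ)]` are independent when `r` is not one of `1, …, m - 1`.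
Multiplied by `∏ (t - qⱼ)`, a combination `∑ xⱼ K(t, qⱼ)` becomes a sum of the `2m` powers with
exponents `0, …, m - 1, r, …, r + m - 1`, which has the `2m` zeros `tᵢ`, `qⱼ`. -/
theorem eq_zero_of_sum_powSlope_eq_zero {m : ℕ} {r : ℝ} (hr : 0 < r)
    (hrm : ∀ k : ℕ, k < m → r ≠ k) {t q : Fin m → ℝ} (ht : ∀ i, 0 < t i) (hq : ∀ i, 0 < q i)
    (ht' : Function.Injective t) (hq' : Function.Injective q) (x : Fin m → ℝ)
    (hx : ∀ i, ∑ j, x j * powSlope r (t i) (q j) = 0) : x = 0 := by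
  rcases Nat.eq_zero_or_pos m with rfl | hm
  · exact Subsingleton.elim _ _
  let Q : Fin m → Polynomial ℝ := fun j =>
    ∏ l ∈ Finset.univ.erase j, (Polynomial.X - Polynomial.C (q l))
  have hQ : ∀ j, (Q j).natDegree ≤ m - 1 := by
    intro j
    rw [Polynomial.natDegree_finsetProd_X_sub_C_eq_card]
    simp
  have hdeg : ∀ c : Fin m → ℝ, (∑ j, Polynomial.C (c j) * Q j).natDegree < m := by
    intro c
    refine lt_of_le_of_lt (Polynomial.natDegree_sum_le_of_forall_le (n := m - 1) _ _ fun j _ =>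
      (Polynomial.natDegree_C_mul_le _ _).trans (hQ j)) (by omega)
  have heval : ∀ (c : Fin m → ℝ) (s : ℝ), (∑ j, Polynomial.C (c j) * Q j).eval s =
      ∑ j, c j * ∏ l ∈ Finset.univ.erase j, (s - q l) := by
    intro c s
    simp [Q, Polynomial.eval_finsetSum, Polynomial.eval_prod]
  let A : Polynomial ℝ := ∑ j, Polynomial.C (x j) * Q j
  let B : Polynomial ℝ := ∑ j, Polynomial.C (x j * q j ^ r) * Q j
  let α : Fin m ⊕ Fin m → ℝ := Sum.elim (fun k => ((k : ℕ) : ℝ)) (fun k => r + ((k : ℕ) : ℝ))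
  let a : Fin m ⊕ Fin m → ℝ := Sum.elim (fun k => - B.coeff k) (fun k => A.coeff k)
  -- a coincidence of exponents would make `r` one of `1, …, m - 1`
  have hcross : ∀ k l : Fin m, ((k : ℕ) : ℝ) ≠ r + ((l : ℕ) : ℝ) := by
    intro k l h
    have h1 : (l : ℕ) < (k : ℕ) := by
      have : ((l : ℕ) : ℝ) < ((k : ℕ) : ℝ) := by linarith
      exact_mod_cast this
    refine hrm ((k : ℕ) - (l : ℕ)) (by omega) ?_
    rw [Nat.cast_sub h1.le]; linarith
  have hα : Function.Injective α := by
    rintro (k | k) (l | l) h <;> simp only [α, Sum.elim_inl, Sum.elim_inr] at h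
    · rw [Nat.cast_inj] at h; rw [Fin.ext h]
    · exact absurd h (hcross k l)
    · exact absurd h.symm (hcross l k)
    · rw [add_right_inj, Nat.cast_inj] at h; rw [Fin.ext h]
  let P : ℝ → ℝ := fun s => ∏ l, (s - q l)
  let φ : ℝ → ℝ := fun s => ∑ j, x j * powSlope r s (q j)
  have hF : ∀ s, 0 < s → ∑ i, a i * s ^ α i = P s * φ s := by
    intro s hs
    have h1 : ∑ i, a i * s ^ α i = s ^ r * A.eval s - B.eval s := by
      rw [Fintype.sum_sum_type, eval_eq_sum_fin (hdeg _) s, eval_eq_sum_fin (hdeg _) s,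
        Finset.mul_sum, ← Finset.sum_sub_distrib, ← Finset.sum_add_distrib]
      refine Finset.sum_congr rfl fun k _ => ?_
      simp only [α, a, Sum.elim_inl, Sum.elim_inr, Real.rpow_add hs]
      ring
    rw [h1]
    simp only [A, B, heval, φ, P]
    rw [Finset.mul_sum, Finset.mul_sum, ← Finset.sum_sub_distrib]
    refine Finset.sum_congr rfl fun j _ => ?_
    rw [← Finset.mul_prod_erase Finset.univ _ (Finset.mem_univ j)]
    linear_combination (-(x j * ∏ l ∈ Finset.univ.erase j, (s - q l))) *
      powSlope_mul_sub r s (q j)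
  have hPq : ∀ j, P (q j) = 0 := fun j =>
    Finset.prod_eq_zero (Finset.mem_univ j) (sub_self _)
  have hφt : ∀ i, φ (t i) = 0 := hx
  have hca : a = 0 := by
    have hT1 : (Finset.univ.image t).card = m := by
      rw [Finset.card_image_of_injective _ ht', Finset.card_univ, Fintype.card_fin]
    have hT2 : (Finset.univ.image q).card = m := by
      rw [Finset.card_image_of_injective _ hq', Finset.card_univ, Fintype.card_fin]
    have hpos : ∀ s ∈ Finset.univ.image t ∪ Finset.univ.image q, 0 < s := by
      intro s hs
      simp only [Finset.mem_union, Finset.mem_image, Finset.mem_univ, true_and] at hs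
      rcases hs with ⟨i, rfl⟩ | ⟨i, rfl⟩
      exacts [ht i, hq i]
    refine coeff_eq_zero_of_double_zeros α hα a (Finset.univ.image t ∪ Finset.univ.image q)
      (Finset.univ.image t ∩ Finset.univ.image q) hpos
      (Finset.inter_subset_left.trans Finset.subset_union_left) ?_ ?_ ?_
    · rw [Finset.card_union_add_card_inter, hT1, hT2]
      simp
    · intro s hs
      rw [hF s (hpos s hs)]
      simp only [Finset.mem_union, Finset.mem_image, Finset.mem_univ, true_and] at hs
      rcases hs with ⟨i, rfl⟩ | ⟨i, rfl⟩
      · rw [hφt, mul_zero]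
      · rw [hPq, zero_mul]
    · intro s hs
      simp only [Finset.mem_inter, Finset.mem_image, Finset.mem_univ, true_and] at hs
      obtain ⟨⟨i, rfl⟩, ⟨j, hj⟩⟩ := hs
      have hP : DifferentiableAt ℝ P (t i) := by
        show DifferentiableAt ℝ (fun s => ∏ l, (s - q l)) (t i)
        fun_prop
      have hc : ContinuousAt φ (t i) :=
        tendsto_finsetSum _ fun l _ =>
          continuousAt_const.mul (continuousAt_powSlope_left r (ht i) (hq l))
      have h0 := hasDerivAt_mul_of_eq_zero hP.hasDerivAt (hj ▸ hPq j) hc (hφt i)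
      refine (hasDerivAt_sum_rpow α a Finset.univ (ht i)).unique (h0.congr_of_eventuallyEq ?_)
      filter_upwards [lt_mem_nhds (ht i)] with s hs
      exact hF s hs
  have hA0 : ∀ s, A.eval s = 0 := by
    intro s
    rw [eval_eq_sum_fin (hdeg _) s]
    exact Finset.sum_eq_zero fun k _ => by
      rw [show A.coeff k = 0 from congrFun hca (Sum.inr k), zero_mul]
  funext j
  have h := hA0 (q j)
  rw [heval, Finset.sum_eq_single j] at h
  · refine (mul_eq_zero.1 h).resolve_right (Finset.prod_ne_zero_iff.2 fun l hl => ?_)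
    exact sub_ne_zero.2 fun e => (Finset.mem_erase.1 hl).1 (hq' e).symm
  · intro l _ hl
    rw [Finset.prod_eq_zero (Finset.mem_erase.2 ⟨Ne.symm hl, Finset.mem_univ j⟩) (sub_self _),
      mul_zero]
  · simp

theorem det_powSlope_ne_zero {m : ℕ} {r : ℝ} (hr : 0 < r)
    (hrm : ∀ k : ℕ, k < m → r ≠ k) {t q : Fin m → ℝ} (ht : ∀ i, 0 < t i) (hq : ∀ i, 0 < q i)
    (ht' : Function.Injective t) (hq' : Function.Injective q) :
    (Matrix.of fun i j => powSlope r (t i) (q j)).det ≠ 0 := by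
  intro h
  obtain ⟨x, hx0, hx⟩ := Matrix.exists_mulVec_eq_zero_iff.2 h
  refine hx0 (eq_zero_of_sum_powSlope_eq_zero hr hrm ht hq ht' hq' x fun i => ?_)
  have := congrFun hx i
  simpa [Matrix.mulVec, dotProduct, mul_comm] using this

theorem IsPreconnected.mul_pos_of_ne_zero {X : Type*} [TopologicalSpace X] {S : Set X}
    (hS : IsPreconnected S) {f : X → ℝ} (hf : ContinuousOn f S) (h0 : ∀ x ∈ S, f x ≠ 0) {x y : X}
    (hx : x ∈ S) (hy : y ∈ S) : 0 < f x * f y := by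
  by_contra! h
  have hneg : ∀ {x y}, x ∈ S → y ∈ S → f x < 0 → 0 < f y → False := by
    intro x y hx hy h1 h2
    obtain ⟨z, hz, hz'⟩ := hS.intermediate_value hx hy hf ⟨h1.le, h2.le⟩
    exact h0 z hz hz'
  rcases lt_or_gt_of_ne (h0 x hx) with h1 | h1 <;> rcases lt_or_gt_of_ne (h0 y hy) with h2 | h2
  · exact absurd h (mul_pos_of_neg_of_neg h1 h2).not_ge
  · exact hneg hx hy h1 h2
  · exact hneg hy hx h2 h1
  · exact absurd h (mul_pos h1 h2).not_ge

/-- Strict sign regularity: the minors of a given size, taken at increasing points, are all of the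
same strict sign, because the pairs of increasing tuples form a convex set. -/
theorem det_powSlope_mul_det_powSlope_pos {m : ℕ} {r : ℝ} (hr : 0 < r)
    (hrm : ∀ k : ℕ, k < m → r ≠ k) {t q t' q' : Fin m → ℝ} (ht : ∀ i, 0 < t i)
    (hq : ∀ i, 0 < q i) (ht' : ∀ i, 0 < t' i) (hq' : ∀ i, 0 < q' i) (mt : StrictMono t)
    (mq : StrictMono q) (mt' : StrictMono t') (mq' : StrictMono q') :
    0 < (Matrix.of fun i j => powSlope r (t i) (q j)).det *
      (Matrix.of fun i j => powSlope r (t' i) (q' j)).det := by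
  let C : Set (Fin m → ℝ) := {t | (∀ i, 0 < t i) ∧ StrictMono t}
  have hC : Convex ℝ C := by
    rintro u ⟨hu, mu⟩ v ⟨hv, mv⟩ a b ha hb hab
    have key : ∀ {x y : ℝ}, 0 < x → 0 < y → 0 < a * x + b * y := by
      intro x y hx hy
      rcases ha.eq_or_lt with h | h
      · have hb1 : b = 1 := by linarith
        simpa [← h, hb1] using hy
      · exact add_pos_of_pos_of_nonneg (mul_pos h hx) (mul_nonneg hb hy.le)
    refine ⟨fun i => by simpa using key (hu i) (hv i), fun i j hij => ?_⟩
    have := key (sub_pos.2 (mu hij)) (sub_pos.2 (mv hij))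
    simp only [Pi.add_apply, Pi.smul_apply, smul_eq_mul]
    linarith
  let f : (Fin m → ℝ) × (Fin m → ℝ) → ℝ := fun z =>
    (Matrix.of fun i j => powSlope r (z.1 i) (z.2 j)).det
  have hf : ContinuousOn f (C ×ˢ C) := by
    intro z hz
    refine ContinuousAt.continuousWithinAt ?_
    simp only [f, Matrix.det_apply]
    refine tendsto_finsetSum _ fun σ _ => Filter.Tendsto.const_smul ?_ _
    refine tendsto_finsetProd _ fun i _ => ?_
    exact (continuousAt_powSlope r (z := (z.1 (σ i), z.2 i)) (hz.1.1 _) (hz.2.1 _)).comp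
      (f := fun z : (Fin m → ℝ) × (Fin m → ℝ) => (z.1 (σ i), z.2 i)) (by fun_prop)
  exact (hC.prod hC).isPreconnected.mul_pos_of_ne_zero hf
    (fun z hz => det_powSlope_ne_zero hr hrm hz.1.1 hz.2.1 hz.1.2.injective hz.2.2.injective)
    (x := (t, q)) (y := (t', q')) ⟨⟨ht, mt⟩, ⟨hq, mq⟩⟩ ⟨⟨ht', mt'⟩, ⟨hq', mq'⟩⟩

/-! ### Inertia of symmetric matrices -/

/-- The number of eigenvalues of a Hermitian matrix that have the sign of `σ`. -/
noncomputable def signCount {n : ℕ} (σ : ℝ) {A : Matrix (Fin n) (Fin n) ℝ}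
    (hA : A.IsHermitian) : ℕ :=
  (Finset.univ.filter fun i => 0 < σ * hA.eigenvalues i).card

theorem hermitianInertia_eq {n : ℕ} {A : Matrix (Fin n) (Fin n) ℝ} (hA : A.IsHermitian) :
    hermitianInertia hA = (signCount 1 hA,
      (Finset.univ.filter fun i => hA.eigenvalues i = 0).card, signCount (-1) hA) := by
  simp [hermitianInertia, signCount]

theorem signCount_add_zero_add {n : ℕ} {A : Matrix (Fin n) (Fin n) ℝ} (hA : A.IsHermitian) :
    signCount 1 hA + (Finset.univ.filter fun i => hA.eigenvalues i = 0).card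
      + signCount (-1) hA = n := by
  have h : ∀ x : ℝ, (if 0 < 1 * x then 1 else 0) + (if x = 0 then 1 else 0)
      + (if 0 < -1 * x then 1 else 0) = 1 := by
    intro x
    rcases lt_trichotomy x 0 with h | h | h
    · simp [h, h.ne, h.le.not_gt]
    · simp [h]
    · simp [h, h.ne', h.le.not_gt]
  simp only [signCount, Finset.card_filter]
  rw [← Finset.sum_add_distrib, ← Finset.sum_add_distrib]
  exact (Finset.sum_congr rfl fun i _ => h (hA.eigenvalues i)).trans (by simp)

/-- Lower bounds that add up to the size of the matrix determine the inertia. -/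
theorem hermitianInertia_of_le {n a b c : ℕ} {A : Matrix (Fin n) (Fin n) ℝ} (hA : A.IsHermitian)
    (ha : a ≤ signCount 1 hA)
    (hb : b ≤ (Finset.univ.filter fun i => hA.eigenvalues i = 0).card)
    (hc : c ≤ signCount (-1) hA) (h : n ≤ a + b + c) : hermitianInertia hA = (a, b, c) := by
  have := signCount_add_zero_add hA
  rw [hermitianInertia_eq, Prod.mk.injEq, Prod.mk.injEq]
  omega

theorem det_eq_zero_iff_zero_lt_card {n : ℕ} {A : Matrix (Fin n) (Fin n) ℝ}
    (hA : A.IsHermitian) :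
    A.det = 0 ↔ 0 < (Finset.univ.filter fun i => hA.eigenvalues i = 0).card := by
  rw [hA.det_eq_prod_eigenvalues, Finset.prod_eq_zero_iff, Finset.card_pos]
  simp [Finset.Nonempty]

theorem card_zero_eigenvalues {n : ℕ} {A : Matrix (Fin n) (Fin n) ℝ} (hA : A.IsHermitian) :
    (Finset.univ.filter fun i => hA.eigenvalues i = 0).card = n - A.rank := by
  have h := Finset.card_filter_add_card_filter_not (s := (Finset.univ : Finset (Fin n)))
    (fun i => hA.eigenvalues i = 0)
  rw [hA.rank_eq_card_non_zero_eigs, Fintype.card_subtype]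
  simp only [Finset.card_univ, Fintype.card_fin] at h
  simp only [ne_eq]
  omega

theorem dotProduct_eq_sum_eigenvectorBasis {n : ℕ} {A : Matrix (Fin n) (Fin n) ℝ}
    (hA : A.IsHermitian) (x y : Fin n → ℝ) :
    x ⬝ᵥ y = ∑ i, ((hA.eigenvectorBasis i).ofLp ⬝ᵥ x) * ((hA.eigenvectorBasis i).ofLp ⬝ᵥ y) := by
  have h := hA.eigenvectorBasis.sum_inner_mul_inner (WithLp.toLp 2 x) (WithLp.toLp 2 y)
  simp only [EuclideanSpace.inner_eq_star_dotProduct, star_trivial] at h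
  rw [dotProduct_comm, ← h]
  exact Finset.sum_congr rfl fun i _ => by rw [dotProduct_comm y]

theorem dotProduct_mulVec_comm {n : ℕ} {A : Matrix (Fin n) (Fin n) ℝ}
    (hA : A.IsHermitian) (x y : Fin n → ℝ) : x ⬝ᵥ A.mulVec y = A.mulVec x ⬝ᵥ y := by
  have hT : A.transpose = A := by simpa [Matrix.conjTranspose_eq_transpose_of_trivial] using hA.eq
  rw [Matrix.dotProduct_mulVec, ← Matrix.mulVec_transpose, hT]

theorem dotProduct_mulVec_eq_sum {n : ℕ} {A : Matrix (Fin n) (Fin n) ℝ}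
    (hA : A.IsHermitian) (x : Fin n → ℝ) :
    x ⬝ᵥ A.mulVec x =
      ∑ i, hA.eigenvalues i * ((hA.eigenvectorBasis i).ofLp ⬝ᵥ x) ^ 2 := by
  rw [dotProduct_eq_sum_eigenvectorBasis hA]
  refine Finset.sum_congr rfl fun i _ => ?_
  rw [dotProduct_mulVec_comm hA, hA.mulVec_eigenvectorBasis, smul_dotProduct, smul_eq_mul]
  ring

/-- The dot products with a family of vectors, as a linear map. -/
noncomputable def dotMap {n : ℕ} {ι : Type*} (v : ι → Fin n → ℝ) : (Fin n → ℝ) →ₗ[ℝ] (ι → ℝ) :=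
  Matrix.mulVecLin (Matrix.of v)

theorem dotMap_apply {n : ℕ} {ι : Type*} (v : ι → Fin n → ℝ) (x : Fin n → ℝ) (i : ι) :
    dotMap v x i = v i ⬝ᵥ x := rfl

theorem le_finrank_ker_dotMap {n : ℕ} {ι : Type*} [Fintype ι] (v : ι → Fin n → ℝ) :
    n ≤ Module.finrank ℝ (LinearMap.ker (dotMap v)) + Fintype.card ι := by
  have h1 := (dotMap v).finrank_range_add_finrank_ker
  have h2 := (LinearMap.range (dotMap v)).finrank_le
  simp only [Module.finrank_fintype_fun_eq_card, Fintype.card_fin] at h1 h2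
  omega

/-- A subspace on which `σ` times the quadratic form is positive meets the span of the eigenvectors
with `σ * λᵢ ≤ 0` only in zero. -/
theorem finrank_le_signCount {n : ℕ} {A : Matrix (Fin n) (Fin n) ℝ} (hA : A.IsHermitian) (σ : ℝ)
    (W : Submodule ℝ (Fin n → ℝ)) (hW : ∀ x ∈ W, x ≠ 0 → 0 < σ * (x ⬝ᵥ A.mulVec x)) :
    Module.finrank ℝ W ≤ signCount σ hA := by
  let f := dotMap fun i : {i // 0 < σ * hA.eigenvalues i} => (hA.eigenvectorBasis i).ofLp
  have hf : Function.Injective (f ∘ₗ W.subtype) := by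
    rw [← LinearMap.ker_eq_bot, LinearMap.ker_eq_bot']
    rintro ⟨x, hx⟩ h
    by_contra hne
    refine (hW x hx fun e => hne (Subtype.ext e)).not_ge ?_
    rw [dotProduct_mulVec_eq_sum hA, Finset.mul_sum]
    refine Finset.sum_nonpos fun i _ => ?_
    by_cases hi : 0 < σ * hA.eigenvalues i
    · have : (hA.eigenvectorBasis i).ofLp ⬝ᵥ x = 0 := congrFun h ⟨i, hi⟩
      simp [this]
    · rw [← mul_assoc]
      exact mul_nonpos_of_nonpos_of_nonneg (not_lt.1 hi) (sq_nonneg _)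
  have := LinearMap.finrank_le_finrank_of_injective hf
  rwa [Module.finrank_fintype_fun_eq_card, Fintype.card_subtype] at this

/-- The span of the eigenvectors with `0 < σ * λᵢ` attains the bound of `finrank_le_signCount`, and
the form is uniformly positive there, which leaves room for perturbations. -/
theorem exists_submodule_signCount {n : ℕ} {A : Matrix (Fin n) (Fin n) ℝ} (hA : A.IsHermitian)
    (σ : ℝ) : ∃ W : Submodule ℝ (Fin n → ℝ), signCount σ hA ≤ Module.finrank ℝ W ∧
      ∃ c > 0, ∀ x ∈ W, c * (x ⬝ᵥ x) ≤ σ * (x ⬝ᵥ A.mulVec x) := by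
  obtain ⟨c, hc, hc'⟩ : ∃ c > 0, ∀ i, 0 < σ * hA.eigenvalues i → c ≤ σ * hA.eigenvalues i := by
    by_cases h : (Finset.univ.filter fun i => 0 < σ * hA.eigenvalues i).Nonempty
    · obtain ⟨i, hi, hmin⟩ := Finset.exists_min_image _ (fun i => σ * hA.eigenvalues i) h
      exact ⟨_, (Finset.mem_filter.1 hi).2, fun j hj => hmin j (by simpa using hj)⟩
    · rw [Finset.not_nonempty_iff_eq_empty, Finset.filter_eq_empty_iff] at h
      exact ⟨1, one_pos, fun i hi => absurd hi (h (Finset.mem_univ i))⟩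
  refine ⟨LinearMap.ker (dotMap fun i : {i // ¬ 0 < σ * hA.eigenvalues i} =>
    (hA.eigenvectorBasis i).ofLp), ?_, c, hc, fun x hx => ?_⟩
  · have h1 := le_finrank_ker_dotMap fun i : {i // ¬ 0 < σ * hA.eigenvalues i} =>
      (hA.eigenvectorBasis i).ofLp
    have h2 := Finset.card_filter_add_card_filter_not (s := (Finset.univ : Finset (Fin n)))
      (fun i => 0 < σ * hA.eigenvalues i)
    rw [Fintype.card_subtype] at h1
    simp only [Finset.card_univ, Fintype.card_fin] at h2
    unfold signCount
    omega
  · rw [dotProduct_mulVec_eq_sum hA, dotProduct_eq_sum_eigenvectorBasis hA, Finset.mul_sum,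
      Finset.mul_sum]
    refine Finset.sum_le_sum fun i _ => ?_
    by_cases hi : 0 < σ * hA.eigenvalues i
    · rw [← mul_assoc σ, ← sq]
      exact mul_le_mul_of_nonneg_right (hc' i hi) (sq_nonneg _)
    · have : (hA.eigenvectorBasis i).ofLp ⬝ᵥ x = 0 := congrFun (LinearMap.mem_ker.1 hx) ⟨i, hi⟩
      simp [this]

theorem dotProduct_self_pos {n : ℕ} {x : Fin n → ℝ} (hx : x ≠ 0) : 0 < x ⬝ᵥ x :=
  lt_of_le_of_ne (Finset.sum_nonneg fun i _ => mul_self_nonneg (x i))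
    fun h => hx (dotProduct_self_eq_zero.1 h.symm)

theorem signCount_submatrix_le {m n : ℕ} {A : Matrix (Fin n) (Fin n) ℝ} (hA : A.IsHermitian)
    {e : Fin m → Fin n} (he : Function.Injective e) (hB : (A.submatrix e e).IsHermitian) (σ : ℝ) :
    signCount σ hB ≤ signCount σ hA := by
  obtain ⟨W, hW, c, hc, h⟩ := exists_submodule_signCount hB σ
  let E : (Fin m → ℝ) →ₗ[ℝ] (Fin n → ℝ) := Function.ExtendByZero.linearMap ℝ e
  have hE : ∀ y i, E y (e i) = y i := fun y i => he.extend_apply y _ i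
  have hEinj : Function.Injective E := fun y z h => by
    funext i; rw [← hE y, h, hE]
  have hdot : ∀ y (z : Fin n → ℝ), E y ⬝ᵥ z = y ⬝ᵥ (z ∘ e) := by
    intro y z
    refine (Fintype.sum_of_injective e he _ _ (fun i hi => ?_) (fun i => ?_)).symm
    · have : E y i = 0 := Function.extend_apply' y _ i (by simpa using hi)
      rw [this, zero_mul]
    · rw [hE]; rfl
  have hq : ∀ y, E y ⬝ᵥ A.mulVec (E y) = y ⬝ᵥ (A.submatrix e e).mulVec y := by
    intro y
    rw [hdot]
    congr 1
    funext i
    show A (e i) ⬝ᵥ E y = _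
    rw [dotProduct_comm, hdot, dotProduct_comm]
    rfl
  calc signCount σ hB ≤ Module.finrank ℝ W := hW
    _ = Module.finrank ℝ (W.map E) := (LinearEquiv.finrank_eq (W.equivMapOfInjective E hEinj))
    _ ≤ signCount σ hA := by
      refine finrank_le_signCount hA σ _ ?_
      rintro _ ⟨y, hy, rfl⟩ hne
      rw [hq]
      refine (mul_pos hc (dotProduct_self_pos ?_)).trans_le (h y hy)
      rintro rfl
      exact hne (map_zero E)

theorem abs_dotProduct_mulVec_le {n : ℕ} (A : Matrix (Fin n) (Fin n) ℝ) (x : Fin n → ℝ) :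
    |x ⬝ᵥ A.mulVec x| ≤ (∑ i, ∑ j, |A i j|) * (x ⬝ᵥ x) := by
  have hx : ∀ i, x i ^ 2 ≤ x ⬝ᵥ x := by
    intro i
    rw [sq]
    exact Finset.single_le_sum (f := fun i => x i * x i) (fun i _ => mul_self_nonneg (x i))
      (Finset.mem_univ i)
  have hxy : ∀ i j, |x i * x j| ≤ x ⬝ᵥ x := by
    intro i j
    rw [abs_le]
    constructor <;> nlinarith [hx i, hx j, sq_nonneg (x i + x j), sq_nonneg (x i - x j)]
  have hsum : x ⬝ᵥ A.mulVec x = ∑ i, ∑ j, A i j * (x i * x j) := by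
    simp only [dotProduct, Matrix.mulVec, Finset.mul_sum]
    exact Finset.sum_congr rfl fun i _ => Finset.sum_congr rfl fun j _ => by ring
  rw [hsum]
  simp only [Finset.sum_mul]
  refine (Finset.abs_sum_le_sum_abs _ _).trans (Finset.sum_le_sum fun i _ => ?_)
  refine (Finset.abs_sum_le_sum_abs _ _).trans (Finset.sum_le_sum fun j _ => ?_)
  rw [abs_mul]
  exact mul_le_mul_of_nonneg_left (hxy i j) (abs_nonneg _)

/-- The numbers of positive and of negative eigenvalues are lower semicontinuous. -/
theorem eventually_signCount_le {X : Type*} {n : ℕ} {A : X → Matrix (Fin n) (Fin n) ℝ}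
    (hA : ∀ s, (A s).IsHermitian) {l : Filter X} {s₀ : X}
    (hc : ∀ i j, Filter.Tendsto (fun s => A s i j) l (nhds (A s₀ i j))) (σ : ℝ) :
    ∀ᶠ s in l, signCount σ (hA s₀) ≤ signCount σ (hA s) := by
  obtain ⟨W, hW, c, hc0, h⟩ := exists_submodule_signCount (hA s₀) σ
  have hlim : Filter.Tendsto (fun s => |σ| * ∑ i, ∑ j, |(A s - A s₀) i j|) l (nhds 0) := by
    have : Filter.Tendsto (fun s => |σ| * ∑ i, ∑ j, |(A s - A s₀) i j|) l
        (nhds (|σ| * ∑ i, ∑ j, |A s₀ i j - A s₀ i j|)) :=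
      Filter.Tendsto.const_mul _ (tendsto_finsetSum _ fun i _ => tendsto_finsetSum _ fun j _ =>
        ((hc i j).sub_const _).abs)
    simpa using this
  filter_upwards [hlim.eventually (gt_mem_nhds hc0)] with s hs
  refine hW.trans (finrank_le_signCount (hA s) σ W fun x hx hne => ?_)
  have h1 := abs_dotProduct_mulVec_le (A s - A s₀) x
  have h2 : x ⬝ᵥ (A s).mulVec x = x ⬝ᵥ (A s₀).mulVec x + x ⬝ᵥ (A s - A s₀).mulVec x := by
    rw [Matrix.sub_mulVec, dotProduct_sub]; ring
  have h3 : |σ * (x ⬝ᵥ (A s - A s₀).mulVec x)| < c * (x ⬝ᵥ x) := by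
    rw [abs_mul]
    calc _ ≤ |σ| * ((∑ i, ∑ j, |(A s - A s₀) i j|) * (x ⬝ᵥ x)) :=
          mul_le_mul_of_nonneg_left h1 (abs_nonneg _)
      _ = (|σ| * ∑ i, ∑ j, |(A s - A s₀) i j|) * (x ⬝ᵥ x) := by ring
      _ < c * (x ⬝ᵥ x) := mul_lt_mul_of_pos_right hs (dotProduct_self_pos hne)
  rw [h2, mul_add]
  linarith [h x hx, neg_abs_le (σ * (x ⬝ᵥ (A s - A s₀).mulVec x))]

/-- Along a connected family of nonsingular symmetric matrices the inertia does not change: both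
sign counts can only increase locally, and their sum is fixed. -/
theorem signCount_eq_of_isPreconnected {X : Type*} [TopologicalSpace X] {n : ℕ}
    {A : X → Matrix (Fin n) (Fin n) ℝ} (hA : ∀ s, (A s).IsHermitian) {S : Set X}
    (hS : IsPreconnected S) (hc : ∀ i j, ContinuousOn (fun s => A s i j) S)
    (hdet : ∀ s ∈ S, (A s).det ≠ 0) {s t : X} (hs : s ∈ S) (ht : t ∈ S) {σ : ℝ}
    (hσ : σ = 1 ∨ σ = -1) : signCount σ (hA s) = signCount σ (hA t) := by
  have hsum : ∀ s ∈ S, signCount 1 (hA s) + signCount (-1) (hA s) = n := by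
    intro s hs
    have h1 := signCount_add_zero_add (hA s)
    have h2 := mt (det_eq_zero_iff_zero_lt_card (hA s)).2 (hdet s hs)
    omega
  refine hS.constant (f := fun s => signCount σ (hA s)) (fun s₀ hs₀ => ?_) hs ht
  show Filter.Tendsto _ _ _
  rw [nhds_discrete, Filter.tendsto_pure]
  filter_upwards [eventually_signCount_le hA (fun i j => hc i j s₀ hs₀) 1,
    eventually_signCount_le hA (fun i j => hc i j s₀ hs₀) (-1), self_mem_nhdsWithin]
    with s h1 h2 hs
  have h3 := hsum s hs
  have h4 := hsum s₀ hs₀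
  rcases hσ with rfl | rfl <;> omega

/-! ### Definiteness for exponents below one -/

theorem rpowIntegrand_sub {r t a b : ℝ} (ht : 0 < t) (ha : 0 < a) (hb : 0 < b) :
    Real.rpowIntegrand₀₁ r t a - Real.rpowIntegrand₀₁ r t b =
      (a - b) * (t ^ r * ((t + a)⁻¹ * (t + b)⁻¹)) := by
  unfold Real.rpowIntegrand₀₁
  have h1 : t + a ≠ 0 := by positivity
  have h2 : t + b ≠ 0 := by positivity
  field_simp
  ring

theorem integrableOn_rpow_mul_inv_mul_inv_of_lt {r a b : ℝ} (hr : r ∈ Set.Ioo (0 : ℝ) 1)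
    (ha : 0 < a) (hab : a < b) :
    MeasureTheory.IntegrableOn (fun t : ℝ => t ^ r * ((t + a)⁻¹ * (t + b)⁻¹)) (Set.Ioi 0) := by
  have hb := ha.trans hab
  refine MeasureTheory.IntegrableOn.congr_fun
    (((Real.integrableOn_rpowIntegrand₀₁_Ioi hr hb.le).sub
      (Real.integrableOn_rpowIntegrand₀₁_Ioi hr ha.le)).const_mul (b - a)⁻¹)
    (fun t ht => ?_) measurableSet_Ioi
  simp only [Pi.sub_apply]
  rw [rpowIntegrand_sub ht hb ha, inv_mul_cancel_left₀ (sub_ne_zero.2 hab.ne'), mul_comm (t + b)⁻¹]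

theorem integrableOn_rpow_mul_inv_mul_inv {r a b : ℝ} (hr : r ∈ Set.Ioo (0 : ℝ) 1)
    (ha : 0 < a) (hb : 0 < b) :
    MeasureTheory.IntegrableOn (fun t : ℝ => t ^ r * ((t + a)⁻¹ * (t + b)⁻¹)) (Set.Ioi 0) := by
  have hc : 0 < min a b / 2 := by positivity
  have hca : min a b / 2 < a := by linarith [min_le_left a b, lt_min ha hb]
  refine (integrableOn_rpow_mul_inv_mul_inv_of_lt hr hc
    (show min a b / 2 < b by linarith [min_le_right a b, lt_min ha hb])).mono'
    (by fun_prop) ?_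
  filter_upwards [MeasureTheory.ae_restrict_mem measurableSet_Ioi] with t ht
  have ht : 0 < t := ht
  rw [Real.norm_of_nonneg (by positivity)]
  gcongr

theorem powSlope_eq_integral {r a b : ℝ} (hr : r ∈ Set.Ioo (0 : ℝ) 1)
    (ha : 0 < a) (hb : 0 < b) (hab : a ≠ b) :
    powSlope r a b = (∫ t in Set.Ioi 0, Real.rpowIntegrand₀₁ r t 1)⁻¹ *
      ∫ t in Set.Ioi (0 : ℝ), t ^ r * ((t + a)⁻¹ * (t + b)⁻¹) := by
  rw [powSlope_of_ne r hab, Real.rpow_eq_const_mul_integral hr ha.le,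
    Real.rpow_eq_const_mul_integral hr hb.le, ← mul_sub, ← MeasureTheory.integral_sub
      (Real.integrableOn_rpowIntegrand₀₁_Ioi hr ha.le)
      (Real.integrableOn_rpowIntegrand₀₁_Ioi hr hb.le),
    MeasureTheory.setIntegral_congr_fun measurableSet_Ioi
      (fun t ht => rpowIntegrand_sub (r := r) ht ha hb),
    MeasureTheory.integral_const_mul, mul_div_assoc, mul_div_cancel_left₀ _ (sub_ne_zero.2 hab)]

theorem integral_rpowIntegrand_one_nonneg {r : ℝ} (hr : r ∈ Set.Ioo (0 : ℝ) 1) :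
    0 ≤ (∫ t in Set.Ioi 0, Real.rpowIntegrand₀₁ r t 1)⁻¹ :=
  inv_nonneg.2 (MeasureTheory.setIntegral_nonneg measurableSet_Ioi fun _ ht =>
    Real.rpowIntegrand₀₁_nonneg hr.1 (le_of_lt ht) zero_le_one)

/-- On the diagonal the integral formula is only needed as a lower bound, which follows from
`powSlope_eq_integral` by letting one argument increase to the other. -/
theorem integral_le_powSlope_self {r a : ℝ} (hr : r ∈ Set.Ioo (0 : ℝ) 1) (ha : 0 < a) :
    (∫ t in Set.Ioi 0, Real.rpowIntegrand₀₁ r t 1)⁻¹ *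
      ∫ t in Set.Ioi (0 : ℝ), t ^ r * ((t + a)⁻¹ * (t + a)⁻¹) ≤ powSlope r a a := by
  have hlim : Filter.Tendsto (fun s => powSlope r s a) (nhdsWithin a (Set.Iio a))
      (nhds (powSlope r a a)) :=
    (continuousAt_powSlope_left r ha ha).tendsto.mono_left nhdsWithin_le_nhds
  refine ge_of_tendsto hlim ?_
  filter_upwards [self_mem_nhdsWithin, mem_nhdsWithin_of_mem_nhds (lt_mem_nhds ha)] with s hsa hs
  have hsa : s < a := hsa
  rw [powSlope_eq_integral hr hs ha hsa.ne]
  refine mul_le_mul_of_nonneg_left ?_ (integral_rpowIntegrand_one_nonneg hr)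
  refine MeasureTheory.setIntegral_mono_on (integrableOn_rpow_mul_inv_mul_inv hr ha ha)
    (integrableOn_rpow_mul_inv_mul_inv hr hs ha) measurableSet_Ioi fun t ht => ?_
  have ht : 0 < t := ht
  gcongr

/-- The quadratic form of the Loewner matrix `L_r`. -/
noncomputable def loewnerForm {n : ℕ} (p : Fin n → ℝ) (r : ℝ) (x : Fin n → ℝ) : ℝ :=
  ∑ i, ∑ j, x i * x j * powSlope r (p i) (p j)

theorem dotProduct_powerLoewner_mulVec {n : ℕ} {p : Fin n → ℝ} (hpos : ∀ i, 0 < p i)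
    (hp : Function.Injective p) (r : ℝ) (x : Fin n → ℝ) :
    x ⬝ᵥ (powerLoewner p r).mulVec x = loewnerForm p r x := by
  simp only [dotProduct, Matrix.mulVec, Finset.mul_sum, loewnerForm,
    powerLoewner_apply hpos hp]
  exact Finset.sum_congr rfl fun i _ => Finset.sum_congr rfl fun j _ => by ring

theorem loewnerForm_nonneg {n : ℕ} {p : Fin n → ℝ} (hpos : ∀ i, 0 < p i)
    (hp : Function.Injective p) {r : ℝ} (hr : r ∈ Set.Ioo (0 : ℝ) 1) (x : Fin n → ℝ) :
    0 ≤ loewnerForm p r x := by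
  set C := (∫ t in Set.Ioi 0, Real.rpowIntegrand₀₁ r t 1)⁻¹ with hC
  have hC0 : 0 ≤ C := integral_rpowIntegrand_one_nonneg hr
  have hint : ∀ i j, MeasureTheory.IntegrableOn
      (fun t : ℝ => x i * x j * (t ^ r * ((t + p i)⁻¹ * (t + p j)⁻¹))) (Set.Ioi 0) :=
    fun i j => (integrableOn_rpow_mul_inv_mul_inv hr (hpos i) (hpos j)).const_mul _
  have h1 : ∑ i, ∑ j, x i * x j * (C * ∫ t in Set.Ioi (0 : ℝ),
      t ^ r * ((t + p i)⁻¹ * (t + p j)⁻¹)) ≤ loewnerForm p r x := by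
    refine Finset.sum_le_sum fun i _ => Finset.sum_le_sum fun j _ => ?_
    by_cases hij : i = j
    · subst hij
      exact mul_le_mul_of_nonneg_left (integral_le_powSlope_self hr (hpos i)) (mul_self_nonneg _)
    · rw [powSlope_eq_integral hr (hpos i) (hpos j) fun e => hij (hp e)]
  refine le_trans ?_ h1
  have h2 : ∑ i, ∑ j, x i * x j * (C * ∫ t in Set.Ioi (0 : ℝ),
      t ^ r * ((t + p i)⁻¹ * (t + p j)⁻¹)) =
      C * ∫ t in Set.Ioi (0 : ℝ), t ^ r * (∑ i, x i * (t + p i)⁻¹) ^ 2 := by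
    have h3 : ∀ t : ℝ, t ^ r * (∑ i, x i * (t + p i)⁻¹) ^ 2 =
        ∑ i, ∑ j, x i * x j * (t ^ r * ((t + p i)⁻¹ * (t + p j)⁻¹)) := by
      intro t
      rw [sq, Finset.sum_mul_sum, Finset.mul_sum]
      refine Finset.sum_congr rfl fun i _ => ?_
      rw [Finset.mul_sum]
      exact Finset.sum_congr rfl fun j _ => by ring
    simp only [h3]
    rw [MeasureTheory.integral_finsetSum _ fun i _ =>
      MeasureTheory.integrable_finsetSum _ fun j _ => hint i j, Finset.mul_sum]
    refine Finset.sum_congr rfl fun i _ => ?_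
    rw [MeasureTheory.integral_finsetSum _ fun j _ => hint i j, Finset.mul_sum]
    refine Finset.sum_congr rfl fun j _ => ?_
    rw [MeasureTheory.integral_const_mul]; ring
  rw [h2]
  refine mul_nonneg hC0 (MeasureTheory.setIntegral_nonneg measurableSet_Ioi fun t ht => ?_)
  have ht : 0 < t := ht
  positivity

theorem det_powerLoewner_ne_zero {n : ℕ} {p : Fin n → ℝ} (hpos : ∀ i, 0 < p i)
    (hp : Function.Injective p) {r : ℝ} (hr : 0 < r) (hrn : ∀ k : ℕ, k < n → r ≠ k) :
    (powerLoewner p r).det ≠ 0 := by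
  have h : powerLoewner p r = Matrix.of fun i j => powSlope r (p i) (p j) := by
    ext i j; exact powerLoewner_apply hpos hp r i j
  rw [h]
  exact det_powSlope_ne_zero hr hrn hpos hpos hp hp

/-- The integral gives a positive semidefinite form, and `L_r` is nonsingular. -/
theorem loewnerForm_pos {n : ℕ} {p : Fin n → ℝ} (hpos : ∀ i, 0 < p i)
    (hp : Function.Injective p) {r : ℝ} (hr : r ∈ Set.Ioo (0 : ℝ) 1) {x : Fin n → ℝ}
    (hx : x ≠ 0) : 0 < loewnerForm p r x := by
  have hA := powerLoewner_isHermitian p r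
  have h1 : (powerLoewner p r).PosSemidef :=
    .of_dotProduct_mulVec_nonneg hA fun x => by
      rw [star_trivial, dotProduct_powerLoewner_mulVec hpos hp]
      exact loewnerForm_nonneg hpos hp hr x
  have hdet : (powerLoewner p r).det ≠ 0 := by
    refine det_powerLoewner_ne_zero hpos hp hr.1 fun k _ h => ?_
    have h1 := hr.1
    have h2 := hr.2
    rw [h] at h1 h2
    have h3 : 0 < k := by exact_mod_cast h1
    have h4 : k < 1 := by exact_mod_cast h2
    omega
  have h2 : (powerLoewner p r).PosDef := by
    refine hA.posDef_iff_eigenvalues_pos.2 fun i => ?_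
    refine lt_of_le_of_ne (h1.eigenvalues_nonneg i) fun h => hdet ?_
    rw [hA.det_eq_prod_eigenvalues]
    exact Finset.prod_eq_zero (Finset.mem_univ i) (by rw [← h]; rfl)
  have := h2.dotProduct_mulVec_pos hx
  rwa [star_trivial, dotProduct_powerLoewner_mulVec hpos hp] at this

theorem powSlope_neg (r : ℝ) {a b : ℝ} (ha : 0 < a) (hb : 0 < b) :
    powSlope (-r) a b = -(a ^ (-r) * b ^ (-r) * powSlope r a b) := by
  by_cases h : a = b
  · subst h
    rw [powSlope_self, powSlope_self, show -r - 1 = -r + -r + (r - 1) by ring,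
      Real.rpow_add ha, Real.rpow_add ha]
    ring
  · rw [powSlope_of_ne _ h, powSlope_of_ne _ h, Real.rpow_neg ha.le, Real.rpow_neg hb.le]
    have h1 := (Real.rpow_pos_of_pos ha r).ne'
    have h2 := (Real.rpow_pos_of_pos hb r).ne'
    have h3 := sub_ne_zero.2 h
    field_simp
    ring

/-- `L_r` is congruent to `-L_{-r}` by `diag(pᵢ ^ r)`. -/
theorem loewnerForm_neg {n : ℕ} {p : Fin n → ℝ} (hpos : ∀ i, 0 < p i)
    (hp : Function.Injective p) {r : ℝ} (hr : r ∈ Set.Ioo (-1 : ℝ) 0) {x : Fin n → ℝ}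
    (hx : x ≠ 0) : loewnerForm p r x < 0 := by
  have hr' : -r ∈ Set.Ioo (0 : ℝ) 1 := ⟨by linarith [hr.2], by linarith [hr.1]⟩
  have h : loewnerForm p r x = -loewnerForm p (-r) fun i => p i ^ r * x i := by
    simp only [loewnerForm, ← Finset.sum_neg_distrib]
    refine Finset.sum_congr rfl fun i _ => Finset.sum_congr rfl fun j _ => ?_
    have := powSlope_neg (-r) (hpos i) (hpos j)
    rw [neg_neg] at this
    rw [this]; ring
  rw [h, neg_lt_zero]
  refine loewnerForm_pos hpos hp hr' fun h0 => hx (funext fun i => ?_)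
  exact (mul_eq_zero.1 (congrFun h0 i)).resolve_left (Real.rpow_pos_of_pos (hpos i) r).ne'

/-! ### Conditional definiteness -/

theorem powSlope_add_two (r : ℝ) {a b : ℝ} (ha : 0 < a) (hb : 0 < b) :
    powSlope (r + 2) a b = a * b * powSlope r a b + (a ^ (r + 1) + b ^ (r + 1)) := by
  have e : ∀ {c : ℝ}, 0 < c → c ^ (r + 1) = c ^ r * c ∧ c ^ (r + 2) = c ^ r * c ^ 2 := by
    intro c hc
    exact ⟨by rw [Real.rpow_add hc, Real.rpow_one],
      by rw [Real.rpow_add hc, Real.rpow_two]⟩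
  by_cases h : a = b
  · subst h
    rw [powSlope_self, powSlope_self, show r + 2 - 1 = r + 1 by ring, (e ha).1,
      Real.rpow_sub ha, Real.rpow_one]
    field_simp
    ring
  · rw [powSlope_of_ne _ h, powSlope_of_ne _ h, (e ha).1, (e ha).2, (e hb).1, (e hb).2]
    have h3 := sub_ne_zero.2 h
    field_simp
    ring

theorem loewnerForm_add_two {n : ℕ} {p : Fin n → ℝ} (hpos : ∀ i, 0 < p i) (r : ℝ)
    {x : Fin n → ℝ} (hx : ∑ i, x i = 0) :
    loewnerForm p (r + 2) x = loewnerForm p r fun i => x i * p i := by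
  have h : loewnerForm p (r + 2) x = loewnerForm p r (fun i => x i * p i)
      + ((∑ i, x i * p i ^ (r + 1)) * ∑ j, x j) + (∑ i, x i) * ∑ j, x j * p j ^ (r + 1) := by
    simp only [loewnerForm, Finset.sum_mul_sum, ← Finset.sum_add_distrib]
    refine Finset.sum_congr rfl fun i _ => Finset.sum_congr rfl fun j _ => ?_
    rw [powSlope_add_two r (hpos i) (hpos j)]; ring
  rw [h, hx]; ring

/-- Raising the exponent by two costs one linear condition: `L_{r + 2}` differs from `D L_r D`
by a matrix `u eᵀ + e uᵀ`, which vanishes as a form on the orthogonal complement of `e`. -/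
theorem loewnerForm_definite_on {n : ℕ} {p : Fin n → ℝ} (hpos : ∀ i, 0 < p i) {r σ : ℝ}
    (h : ∀ x, x ≠ 0 → 0 < σ * loewnerForm p r x) (k : ℕ) :
    ∀ x : Fin n → ℝ, x ≠ 0 → (∀ a < k, ∑ i, x i * p i ^ a = 0) →
      0 < σ * loewnerForm p (r + 2 * k) x := by
  induction k with
  | zero => intro x hx _; simpa using h x hx
  | succ k ih =>
    intro x hx h0
    have e : r + 2 * ((k + 1 : ℕ) : ℝ) = (r + 2 * k) + 2 := by push_cast; ring
    rw [e, loewnerForm_add_two hpos _ (by simpa using h0 0 (Nat.succ_pos k))]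
    refine ih _ (fun hz => hx (funext fun i => ?_)) fun a ha => ?_
    · exact (mul_eq_zero.1 (congrFun hz i)).resolve_right (hpos i).ne'
    · rw [← h0 (a + 1) (by omega)]
      exact Finset.sum_congr rfl fun i _ => by rw [pow_succ]; ring

/-- The subspace given by the conditions `∑ xᵢ pᵢ ^ a = 0`, `a < k`, has codimension at most `k`. -/
theorem sub_le_signCount {n : ℕ} {p : Fin n → ℝ} (hpos : ∀ i, 0 < p i)
    (hp : Function.Injective p) {r σ : ℝ} (h : ∀ x, x ≠ 0 → 0 < σ * loewnerForm p r x) (k : ℕ) :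
    n - k ≤ signCount σ (powerLoewner_isHermitian p (r + 2 * k)) := by
  have h1 := le_finrank_ker_dotMap fun (a : Fin k) (i : Fin n) => p i ^ (a : ℕ)
  rw [Fintype.card_fin] at h1
  refine (Nat.sub_le_iff_le_add.2 h1).trans (finrank_le_signCount _ σ _ fun x hx hne => ?_)
  rw [dotProduct_powerLoewner_mulVec hpos hp]
  refine loewnerForm_definite_on hpos h k x hne fun a ha => ?_
  have := congrFun (LinearMap.mem_ker.1 hx) ⟨a, ha⟩
  rw [dotMap_apply, dotProduct_comm] at this
  exact this

theorem sub_le_signCount_one {n : ℕ} {p : Fin n → ℝ} (hpos : ∀ i, 0 < p i)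
    (hp : Function.Injective p) {r : ℝ} {k : ℕ} (h1 : 2 * (k : ℝ) < r) (h2 : r < 2 * k + 1) :
    n - k ≤ signCount 1 (powerLoewner_isHermitian p r) := by
  have := sub_le_signCount hpos hp (r := r - 2 * k) (σ := 1) (fun x hx => by
    rw [one_mul]; exact loewnerForm_pos hpos hp ⟨by linarith, by linarith⟩ hx) k
  simpa using this

theorem sub_le_signCount_neg_one {n : ℕ} {p : Fin n → ℝ} (hpos : ∀ i, 0 < p i)
    (hp : Function.Injective p) {r : ℝ} {k : ℕ} (h1 : 2 * (k : ℝ) - 1 < r) (h2 : r < 2 * k) :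
    n - k ≤ signCount (-1) (powerLoewner_isHermitian p r) := by
  have := sub_le_signCount hpos hp (r := r - 2 * k) (σ := -1) (fun x hx => by
    have := loewnerForm_neg hpos hp (r := r - 2 * k) ⟨by linarith, by linarith⟩ hx
    linarith) k
  simpa using this

/-! ### Inertia of Loewner matrices -/

theorem signCount_congr {n : ℕ} {A B : Matrix (Fin n) (Fin n) ℝ} (hA : A.IsHermitian)
    (hB : B.IsHermitian) (h : A = B) (σ : ℝ) : signCount σ hA = signCount σ hB := by
  subst h; rfl

theorem continuous_powerLoewner {n : ℕ} {p : Fin n → ℝ} (hpos : ∀ i, 0 < p i)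
    (hp : Function.Injective p) (i j : Fin n) : Continuous fun r => powerLoewner p r i j := by
  simp only [powerLoewner_apply hpos hp]
  by_cases h : p i = p j
  · rw [h]
    simp only [powSlope_self]
    exact continuous_id.mul ((Real.continuous_const_rpow (hpos j).ne').comp
      (continuous_id.sub continuous_const))
  · simp only [powSlope_of_ne _ h]
    exact ((Real.continuous_const_rpow (hpos i).ne').sub
      (Real.continuous_const_rpow (hpos j).ne')).div_const _

/-- The sign counts at `m` of the points and an exponent `r' > m - 1` bound those at all points and
every other exponent `r > m - 1`: a principal submatrix, then a path of nonsingular matrices. -/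
theorem signCount_castLE_le {m n : ℕ} (hmn : m ≤ n) (hm : 1 ≤ m) {p : Fin n → ℝ}
    (hpos : ∀ i, 0 < p i) (hp : Function.Injective p) {r r' σ : ℝ} (hr : (m : ℝ) - 1 < r)
    (hr' : (m : ℝ) - 1 < r') (hσ : σ = 1 ∨ σ = -1) :
    signCount σ (powerLoewner_isHermitian (p ∘ Fin.castLE hmn) r') ≤
      signCount σ (powerLoewner_isHermitian p r) := by
  have he := Fin.castLE_injective hmn
  have hm' : (1 : ℝ) ≤ m := by exact_mod_cast hm
  have h1 : signCount σ (powerLoewner_isHermitian (p ∘ Fin.castLE hmn) r') =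
      signCount σ (powerLoewner_isHermitian (p ∘ Fin.castLE hmn) r) := by
    refine signCount_eq_of_isPreconnected (fun s => powerLoewner_isHermitian _ s)
      (S := Set.Ioi ((m : ℝ) - 1)) isPreconnected_Ioi
      (fun i j => (continuous_powerLoewner (fun i => hpos _) (hp.comp he) i j).continuousOn)
      (fun s hs => ?_) hr' hr hσ
    have hs : (m : ℝ) - 1 < s := hs
    refine det_powerLoewner_ne_zero (fun i => hpos _) (hp.comp he) (by linarith) fun k hk h => ?_
    have : (k : ℝ) + 1 ≤ m := by exact_mod_cast hk
    linarith
  have h2 : (powerLoewner p r).submatrix (Fin.castLE hmn) (Fin.castLE hmn) =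
      powerLoewner (p ∘ Fin.castLE hmn) r := by
    ext i j
    rw [powerLoewner_apply (p := p ∘ Fin.castLE hmn) (fun i => hpos _) (hp.comp he),
      Matrix.submatrix_apply, powerLoewner_apply hpos hp]
    rfl
  rw [h1, ← signCount_congr (h2 ▸ powerLoewner_isHermitian _ r) _ h2]
  exact signCount_submatrix_le _ he _ σ

/-- The bound comes from the first `2k` points and the exponent `2k - 1/2`, where `L` has `k`
negative eigenvalues by `sub_le_signCount_neg_one`. -/
theorem le_signCount_neg_one {n k : ℕ} (hk : 2 * k ≤ n) {p : Fin n → ℝ} (hpos : ∀ i, 0 < p i)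
    (hp : Function.Injective p) {r : ℝ} (hr : 2 * (k : ℝ) - 1 < r) :
    k ≤ signCount (-1) (powerLoewner_isHermitian p r) := by
  rcases Nat.eq_zero_or_pos k with rfl | hk0
  · exact Nat.zero_le _
  have h1 := sub_le_signCount_neg_one (p := p ∘ Fin.castLE hk) (fun i => hpos _)
    (hp.comp (Fin.castLE_injective hk)) (r := 2 * k - 1 / 2) (k := k) (by linarith) (by linarith)
  have h2 := signCount_castLE_le hk (by omega) hpos hp (r := r) (r' := 2 * k - 1 / 2) (σ := -1)
    (by push_cast; linarith) (by push_cast; linarith) (Or.inr rfl)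
  omega

/-- The bound comes from the first `2k - 1` points and the exponent `2k - 3/2`, where `L` has `k`
positive eigenvalues by `sub_le_signCount_one`. -/
theorem le_signCount_one {n k : ℕ} (hk0 : 1 ≤ k) (hk : 2 * k - 1 ≤ n) {p : Fin n → ℝ}
    (hpos : ∀ i, 0 < p i) (hp : Function.Injective p) {r : ℝ} (hr : 2 * (k : ℝ) - 2 < r) :
    k ≤ signCount 1 (powerLoewner_isHermitian p r) := by
  obtain ⟨l, rfl⟩ := Nat.exists_eq_add_of_le' hk0
  have e : 2 * (l + 1) - 1 = 2 * l + 1 := by omega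
  rw [e] at hk
  push_cast at hr
  have h1 := sub_le_signCount_one (p := p ∘ Fin.castLE hk) (fun i => hpos _)
    (hp.comp (Fin.castLE_injective hk)) (r := 2 * l + 1 / 2) (k := l) (by linarith) (by linarith)
  have h2 := signCount_castLE_le hk (by omega) hpos hp (r := r) (r' := 2 * l + 1 / 2) (σ := 1)
    (by push_cast; linarith) (by push_cast; linarith) (Or.inl rfl)
  omega

theorem powSlope_natCast (m : ℕ) (a b : ℝ) :
    powSlope m a b = ∑ i ∈ Finset.range m, a ^ i * b ^ (m - 1 - i) := by
  by_cases h : a = b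
  · subst h
    rw [powSlope_self]
    rcases m with _ | m
    · simp
    · rw [show ((m + 1 : ℕ) : ℝ) - 1 = (m : ℕ) by push_cast; ring, Real.rpow_natCast,
        Finset.sum_congr rfl (g := fun _ => a ^ m) fun i hi => ?_]
      · simp
      · rw [← pow_add]
        congr 1
        have := Finset.mem_range.1 hi
        omega
  · rw [powSlope_of_ne _ h, Real.rpow_natCast, Real.rpow_natCast, (Commute.all a b).geom_sum₂ h]

theorem rank_powerLoewner_natCast_le {n : ℕ} {p : Fin n → ℝ} (hpos : ∀ i, 0 < p i)
    (hp : Function.Injective p) (m : ℕ) : (powerLoewner p (m : ℝ)).rank ≤ m := by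
  have h : powerLoewner p (m : ℝ) = (Matrix.of fun (i : Fin n) (a : Fin m) => p i ^ (a : ℕ)) *
      Matrix.of fun (a : Fin m) (j : Fin n) => p j ^ (m - 1 - (a : ℕ)) := by
    ext i j
    rw [powerLoewner_apply hpos hp, powSlope_natCast, Finset.sum_range, Matrix.mul_apply]
    rfl
  rw [h]
  exact (Matrix.rank_mul_le_left _ _).trans (Matrix.rank_le_width _)

theorem sub_le_card_zero_eigenvalues {n : ℕ} {p : Fin n → ℝ} (hpos : ∀ i, 0 < p i)
    (hp : Function.Injective p) {m : ℕ} {r : ℝ} (hr : r = m) :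
    n - m ≤ (Finset.univ.filter fun i =>
      (powerLoewner_isHermitian p r).eigenvalues i = 0).card := by
  subst hr
  rw [card_zero_eigenvalues]
  exact Nat.sub_le_sub_left (rank_powerLoewner_natCast_le hpos hp m) n

theorem det_powerLoewner_eq_zero_iff {n : ℕ} {p : Fin n → ℝ} (hpos : ∀ i, 0 < p i)
    (hp : Function.Injective p) {r : ℝ} (hr : 0 < r) :
    (powerLoewner p r).det = 0 ↔ ∃ m : ℕ, 1 ≤ m ∧ m < n ∧ r = (m : ℝ) := by
  constructor
  · intro h
    by_contra! hne
    refine det_powerLoewner_ne_zero hpos hp hr (fun k hk e => ?_) h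
    refine hne k (Nat.one_le_iff_ne_zero.2 fun hk0 => ?_) hk e
    rw [hk0, Nat.cast_zero] at e
    exact hr.ne' e
  · rintro ⟨m, -, hm, e⟩
    rw [det_eq_zero_iff_zero_lt_card (powerLoewner_isHermitian p r)]
    have := sub_le_card_zero_eigenvalues hpos hp e
    omega

theorem loewnerInertia_of_lt {n : ℕ} {p : Fin n → ℝ} (hpos : ∀ i, 0 < p i)
    (hp : Function.Injective p) {r : ℝ} (hr : (n : ℝ) - 1 < r) :
    loewnerInertia p r = ((n + 1) / 2, 0, n / 2) := by
  refine hermitianInertia_of_le _ ?_ (Nat.zero_le _) (le_signCount_neg_one (by omega) hpos hp ?_)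
    (by omega)
  · rcases Nat.eq_zero_or_pos n with h0 | h0
    · simp [h0]
    · refine le_signCount_one (by omega) (by omega) hpos hp ?_
      have : 2 * (((n + 1) / 2 : ℕ) : ℝ) ≤ n + 1 := by
        exact_mod_cast Nat.mul_div_le (n + 1) 2
      linarith
  · have : 2 * ((n / 2 : ℕ) : ℝ) ≤ n := by exact_mod_cast Nat.mul_div_le n 2
    linarith

/-! ### Simplicity of the nonzero eigenvalues -/

theorem exists_sign_blocks_nat (x : ℕ → ℝ) (N : ℕ) (h : ∃ j < N, x j ≠ 0) :
    ∃ (s : ℕ) (B e : ℕ → ℕ) (ε : ℝ), (ε = 1 ∨ ε = -1) ∧ (∀ i j, i ≤ j → j < N → B i ≤ B j) ∧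
      (∀ j < N, B j ≤ s) ∧ (∀ j < N, 0 ≤ ε * (-1) ^ B j * x j) ∧
      ∀ l ≤ s, e l < N ∧ B (e l) = l ∧ x (e l) ≠ 0 := by
  induction N with
  | zero => obtain ⟨j, hj, -⟩ := h; exact absurd hj (Nat.not_lt_zero j)
  | succ N ih =>
    by_cases hN : ∃ j < N, x j ≠ 0
    · obtain ⟨s, B, e, ε, hε, hB, hBs, hx, he⟩ := ih hN
      -- the new entry joins the last block or opens a new one
      have key : ∀ s', s ≤ s' → (0 ≤ ε * (-1) ^ s' * x N) → ∀ e' : ℕ → ℕ,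
          (∀ l ≤ s, e' l = e l) → (∀ l ≤ s', s < l → l = s' ∧ e' l = N ∧ x N ≠ 0) →
          ∃ (s : ℕ) (B e : ℕ → ℕ) (ε : ℝ), (ε = 1 ∨ ε = -1) ∧
            (∀ i j, i ≤ j → j < N + 1 → B i ≤ B j) ∧
            (∀ j < N + 1, B j ≤ s) ∧ (∀ j < N + 1, 0 ≤ ε * (-1) ^ B j * x j) ∧
            ∀ l ≤ s, e l < N + 1 ∧ B (e l) = l ∧ x (e l) ≠ 0 := by
        intro s' hs' hxN e' he1 he2
        refine ⟨s', fun j => if j < N then B j else s', e', ε, hε, fun i j hij hj => ?_,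
          fun j hj => ?_, fun j hj => ?_, fun l hl => ?_⟩
        · by_cases h1 : j < N
          · simpa [h1, hij.trans_lt h1] using hB i j hij h1
          · by_cases h2 : i < N
            · simpa [h1, h2] using (hBs i h2).trans hs'
            · simp [h1, h2]
        · by_cases h1 : j < N
          · simpa [h1] using (hBs j h1).trans hs'
          · simp [h1]
        · by_cases h1 : j < N
          · simpa [h1] using hx j h1
          · have : j = N := by omega
            subst this
            simpa using hxN
        · by_cases h1 : l ≤ s
          · obtain ⟨h2, h3, h4⟩ := he l h1
            rw [he1 l h1]
            exact ⟨by omega, by simp [h2, h3], h4⟩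
          · obtain ⟨h2, h3, h4⟩ := he2 l hl (by omega)
            rw [h3]
            exact ⟨by omega, by simp [h2], h4⟩
      by_cases hxN : 0 ≤ ε * (-1) ^ s * x N
      · exact key s le_rfl hxN e (fun _ _ => rfl) fun l h1 h2 => by omega
      · push Not at hxN
        refine key (s + 1) (by omega) (by rw [pow_succ]; linarith)
          (fun l => if l ≤ s then e l else N) (fun l hl => by simp [hl]) fun l h1 h2 => ?_
        refine ⟨by omega, by simp [h2], fun h => ?_⟩
        rw [h, mul_zero] at hxN
        exact lt_irrefl _ hxN
    · push Not at hN
      have hxN : x N ≠ 0 := by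
        obtain ⟨j, hj, hj0⟩ := h
        rcases Nat.lt_succ_iff_lt_or_eq.1 hj with h | rfl
        · exact absurd (hN j h) hj0
        · exact hj0
      obtain ⟨ε, hε, hx⟩ : ∃ ε : ℝ, (ε = 1 ∨ ε = -1) ∧ 0 ≤ ε * x N := by
        rcases le_total 0 (x N) with h | h
        · exact ⟨1, Or.inl rfl, by linarith⟩
        · exact ⟨-1, Or.inr rfl, by linarith⟩
      refine ⟨0, fun _ => 0, fun _ => N, ε, hε, by simp, by simp, fun j hj => ?_, fun l hl => ?_⟩
      · rcases Nat.lt_succ_iff_lt_or_eq.1 hj with h | rfl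
        · simp [hN j h]
        · simpa using hx
      · exact ⟨Nat.lt_succ_self N, (Nat.le_zero.1 hl).symm, hxN⟩

/-- A nonzero real vector is cut into consecutive blocks `B` on which its sign is constant, with
alternating signs `ε * (-1) ^ l`; `e l` is an index of block `l` with a nonzero entry. -/
theorem exists_sign_blocks {n : ℕ} {x : Fin n → ℝ} (hx : x ≠ 0) :
    ∃ (s : ℕ) (B : Fin n → Fin (s + 1)) (e : Fin (s + 1) → Fin n) (ε : ℝ), (ε = 1 ∨ ε = -1) ∧
      Monotone B ∧ (∀ j, 0 ≤ ε * (-1) ^ (B j : ℕ) * x j) ∧ ∀ l, B (e l) = l ∧ x (e l) ≠ 0 := by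
  let y : ℕ → ℝ := fun j => if h : j < n then x ⟨j, h⟩ else 0
  have hy : ∀ j : Fin n, y j = x j := fun j => by simp [y]
  obtain ⟨i, hi⟩ := Function.ne_iff.1 hx
  obtain ⟨s, B, e, ε, hε, hB, hBs, hs, he⟩ := exists_sign_blocks_nat y n
    ⟨i, i.2, by rw [hy]; exact hi⟩
  have hl : ∀ l : Fin (s + 1), (l : ℕ) ≤ s := fun l => by omega
  refine ⟨s, fun j => ⟨B j, Nat.lt_succ_of_le (hBs j j.2)⟩, fun l => ⟨e l, (he l (hl l)).1⟩, ε, hε,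
    fun i j hij => hB i j hij j.2, fun j => by simpa [hy] using hs j j.2, fun l => ⟨?_, ?_⟩⟩
  · exact Fin.ext (he l (hl l)).2.1
  · rw [← hy]; exact (he l (hl l)).2.2

theorem strictMono_of_blocks {n m : ℕ} {B : Fin n → Fin m} (hB : Monotone B) {f : Fin m → Fin n}
    (hf : ∀ l, B (f l) = l) : StrictMono f := by
  intro l l' h
  by_contra! h'
  have := hB h'
  rw [hf, hf] at this
  exact absurd h this.not_gt

/-- Variation diminution: if `x` has `s` sign changes and `∑ xⱼ K(t, pⱼ)` vanishes at `s + 1`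
points, then minors of size `s + 1` cannot exist with a common strict sign: after adding up the
columns of each sign block, the determinant is a sum of such minors with nonnegative weights, and
the alternating signs give a kernel vector. -/
theorem exists_eq_natCast_of_sum_eq_zero {n s : ℕ} {r : ℝ} (hr : 0 < r) {p : Fin n → ℝ}
    (hpos : ∀ i, 0 < p i) (hmono : StrictMono p) {x : Fin n → ℝ} {B : Fin n → Fin (s + 1)}
    {e : Fin (s + 1) → Fin n} {ε : ℝ} (hε : ε = 1 ∨ ε = -1) (hB : Monotone B)
    (hs : ∀ j, 0 ≤ ε * (-1) ^ (B j : ℕ) * x j) (he : ∀ l, B (e l) = l ∧ x (e l) ≠ 0)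
    {t : Fin (s + 1) → ℝ} (ht : ∀ i, 0 < t i) (mt : StrictMono t)
    (h0 : ∀ i, ∑ j, x j * powSlope r (t i) (p j) = 0) : ∃ k : ℕ, k < s + 1 ∧ r = k := by
  by_contra! hrs
  let S : Fin (s + 1) → Finset (Fin n) := fun l => Finset.univ.filter fun j => B j = l
  let row : Fin n → Fin (s + 1) → ℝ := fun j i => powSlope r (p j) (t i)
  let M : Matrix (Fin (s + 1)) (Fin (s + 1)) ℝ := fun l => ∑ j ∈ S l, |x j| • row j
  have hsgn : ∀ l : ℕ, ε * (-1) ^ l = 1 ∨ ε * (-1) ^ l = -1 := by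
    intro l
    rcases hε with rfl | rfl <;> rcases neg_one_pow_eq_or ℝ l with h | h <;> simp [h]
  have habs : ∀ j, (ε * (-1) ^ (B j : ℕ)) * |x j| = x j := by
    intro j
    have h1 := hs j
    rcases hsgn (B j) with h | h <;> rw [h] at h1 ⊢
    · rw [abs_of_nonneg (by linarith)]; ring
    · rw [abs_of_nonpos (by linarith)]; ring
  have hM0 : M.det = 0 := by
    refine Matrix.exists_vecMul_eq_zero_iff.1
      ⟨fun l => ε * (-1) ^ (l : ℕ), fun h => ?_, funext fun i => ?_⟩
    · have h1 : ε * (-1) ^ ((0 : Fin (s + 1)) : ℕ) = 0 := congrFun h 0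
      rcases hsgn ((0 : Fin (s + 1)) : ℕ) with h | h <;> rw [h] at h1 <;> norm_num at h1
    · show ∑ l : Fin (s + 1), ε * (-1) ^ (l : ℕ) * M l i = 0
      rw [← h0 i, ← Finset.sum_fiberwise Finset.univ B]
      refine Finset.sum_congr rfl fun l _ => ?_
      simp only [M, Finset.sum_apply, Finset.mul_sum]
      refine Finset.sum_congr rfl fun j hj => ?_
      obtain rfl : B j = l := (Finset.mem_filter.1 hj).2
      simp only [row, Pi.smul_apply, smul_eq_mul]
      rw [← mul_assoc, habs, powSlope_comm]
  have hexp : M.det = ∑ f ∈ Fintype.piFinset S,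
      (∏ l, |x (f l)|) * (Matrix.of fun l i => powSlope r (p (f l)) (t i)).det := by
    have h1 := (Matrix.detRowAlternating (n := Fin (s + 1)) (R := ℝ)).toMultilinearMap.map_sum_finset
      (fun _ j => |x j| • row j) S
    refine h1.trans (Finset.sum_congr rfl fun f _ => ?_)
    exact (Matrix.detRowAlternating (n := Fin (s + 1)) (R := ℝ)).toMultilinearMap.map_smul_univ
      (fun l => |x (f l)|) (fun l => row (f l))
  have hfm : ∀ f : Fin (s + 1) → Fin n, (∀ l, B (f l) = l) →
      0 < (Matrix.of fun l i => powSlope r (p (f l)) (t i)).det *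
        (Matrix.of fun l i => powSlope r (p (e l)) (t i)).det := by
    intro f hf
    exact det_powSlope_mul_det_powSlope_pos hr hrs (fun _ => hpos _) ht (fun _ => hpos _) ht
      (hmono.comp (strictMono_of_blocks hB hf)) mt
      (hmono.comp (strictMono_of_blocks hB fun l => (he l).1)) mt
  have hpos' : 0 < M.det * (Matrix.of fun l i => powSlope r (p (e l)) (t i)).det := by
    rw [hexp, Finset.sum_mul]
    refine Finset.sum_pos' (fun f hf => ?_) ⟨e, ?_, ?_⟩
    · rw [mul_assoc]
      refine mul_nonneg (Finset.prod_nonneg fun l _ => abs_nonneg _) (hfm f fun l => ?_).le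
      exact (Finset.mem_filter.1 (Fintype.mem_piFinset.1 hf l)).2
    · exact Fintype.mem_piFinset.2 fun l => Finset.mem_filter.2 ⟨Finset.mem_univ _, (he l).1⟩
    · rw [mul_assoc]
      exact mul_pos (Finset.prod_pos fun l _ => abs_pos.2 (he l).2) (hfm e fun l => (he l).1)
  rw [hM0, zero_mul] at hpos'
  exact lt_irrefl _ hpos'

/-- At an integer exponent `k` the sum is a polynomial in `u` of degree less than `k`. -/
theorem sum_powSlope_eq_zero_of_natCast {n s k : ℕ} {p : Fin n → ℝ} (x : Fin n → ℝ)
    {t : Fin s → ℝ} (ht : ∀ i, 0 < t i) (ht' : Function.Injective t) (hk : k ≤ s)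
    (h0 : ∀ i, ∑ j, x j * powSlope k (t i) (p j) = 0) (u : ℝ) :
    ∑ j, x j * powSlope k u (p j) = 0 := by
  have e : ∀ u : ℝ, ∑ j, x j * powSlope k u (p j) =
      ∑ a ∈ Finset.range k, (∑ j, x j * p j ^ (k - 1 - a)) * u ^ a := by
    intro u
    simp only [powSlope_natCast, Finset.mul_sum, Finset.sum_mul]
    rw [Finset.sum_comm]
    exact Finset.sum_congr rfl fun a _ => Finset.sum_congr rfl fun j _ => by ring
  have hc := coeff_eq_zero_of_zeros (fun a : ℕ => (a : ℝ)) Nat.cast_injective (Finset.range k)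
    (fun a => ∑ j, x j * p j ^ (k - 1 - a)) (Finset.univ.image t)
    (fun v hv => by obtain ⟨i, -, rfl⟩ := Finset.mem_image.1 hv; exact ht i)
    (by rw [Finset.card_image_of_injective _ ht']; simpa using hk)
    (fun v hv => by
      obtain ⟨i, -, rfl⟩ := Finset.mem_image.1 hv
      simp only [Real.rpow_natCast]
      rw [← e, h0])
  rw [e]
  exact Finset.sum_eq_zero fun a ha => by rw [hc a ha, zero_mul]

/-- An eigenvector for a nonzero eigenvalue has a nonzero first entry. If it has `s` sign changes
and first entry zero, then `∑ xⱼ K(t, pⱼ)`, which takes the value `μ xᵢ` at `pᵢ`, has one zero for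
each sign change and another one at the first point: one more than variation diminution allows. -/
theorem eq_zero_of_mulVec_eq_smul {n : ℕ} {p : Fin n → ℝ} (hpos : ∀ i, 0 < p i)
    (hmono : StrictMono p) {r : ℝ} (hr : 0 < r) {μ : ℝ} (hμ : μ ≠ 0) {x : Fin n → ℝ}
    (hx : (powerLoewner p r).mulVec x = μ • x) {i₀ : Fin n} (hi₀ : ∀ i, i₀ ≤ i)
    (hx₀ : x i₀ = 0) : x = 0 := by
  by_contra hne
  obtain ⟨s, B, e, ε, hε, hB, hs, he⟩ := exists_sign_blocks hne
  let φ : ℝ → ℝ := fun t => ∑ j, x j * powSlope r t (p j)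
  have hφ : ∀ i, φ (p i) = μ * x i := by
    intro i
    have := congrFun hx i
    rw [Pi.smul_apply, smul_eq_mul] at this
    rw [← this]
    simp only [φ, Matrix.mulVec, dotProduct, powerLoewner_apply hpos hmono.injective]
    exact Finset.sum_congr rfl fun j _ => mul_comm _ _
  have hc : ∀ t, 0 < t → ContinuousAt φ t := fun t ht =>
    tendsto_finsetSum _ fun j _ =>
      continuousAt_const.mul (continuousAt_powSlope_left r ht (hpos j))
  have he_mono : StrictMono e := strictMono_of_blocks hB fun l => (he l).1
  have hzero : ∀ l : Fin s, ∃ u, p (e l.castSucc) < u ∧ u < p (e l.succ) ∧ φ u = 0 := by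
    intro l
    have hlt : p (e l.castSucc) < p (e l.succ) := hmono (he_mono l.castSucc_lt_succ)
    have hcont : ContinuousOn φ (Set.Icc (p (e l.castSucc)) (p (e l.succ))) := fun t ht =>
      (hc t ((hpos _).trans_le ht.1)).continuousWithinAt
    have hneg : φ (p (e l.castSucc)) * φ (p (e l.succ)) < 0 := by
      have h1 := hs (e l.castSucc)
      have h2 := hs (e l.succ)
      rw [(he _).1] at h1 h2
      have h3 := (he l.castSucc).2
      have h4 := (he l.succ).2
      rw [hφ, hφ]
      have h5 : x (e l.castSucc) * x (e l.succ) ≤ 0 := by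
        have h6 := mul_nonneg h1 h2
        simp only [Fin.val_castSucc, Fin.val_succ, pow_succ] at h6
        have h7 : ε * ε = 1 := by rcases hε with rfl | rfl <;> norm_num
        have h8 : ((-1 : ℝ) ^ (l : ℕ)) * (-1) ^ (l : ℕ) = 1 := by
          rw [← mul_pow]; norm_num
        have h9 : ε * (-1) ^ (l : ℕ) * x (e l.castSucc) *
            (ε * ((-1) ^ (l : ℕ) * -1) * x (e l.succ)) =
            -(x (e l.castSucc) * x (e l.succ)) := by
          linear_combination (-(x (e l.castSucc) * x (e l.succ))) *
            ((-1) ^ (l : ℕ) * (-1) ^ (l : ℕ) * h7 + h8)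
        linarith
      have h6 : x (e l.castSucc) * x (e l.succ) < 0 := lt_of_le_of_ne h5 (mul_ne_zero h3 h4)
      have h7 : 0 < μ * μ := mul_self_pos.2 hμ
      nlinarith [mul_neg_of_pos_of_neg h7 h6]
    have hend : ∀ u, u = p (e l.castSucc) ∨ u = p (e l.succ) → φ u ≠ 0 := by
      rintro u (rfl | rfl) h <;> rw [h] at hneg <;> simp at hneg
    obtain ⟨u, hu, hu0⟩ : ∃ u ∈ Set.Icc (p (e l.castSucc)) (p (e l.succ)), φ u = 0 := by
      rcases mul_neg_iff.1 hneg with ⟨h1, h2⟩ | ⟨h1, h2⟩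
      · exact intermediate_value_Icc' hlt.le hcont ⟨h2.le, h1.le⟩
      · exact intermediate_value_Icc hlt.le hcont ⟨h1.le, h2.le⟩
    exact ⟨u, lt_of_le_of_ne hu.1 fun h => hend u (Or.inl h.symm) hu0,
      lt_of_le_of_ne hu.2 fun h => hend u (Or.inr h) hu0, hu0⟩
  choose u hu1 hu2 hu0 using hzero
  let t : Fin (s + 1) → ℝ := Fin.cons (p i₀) u
  have hte : ∀ l, t l ≤ p (e l) := by
    intro l
    refine Fin.cases ?_ (fun l => ?_) l
    · exact hmono.monotone (hi₀ _)
    · exact (hu2 l).le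
  have mt : StrictMono t := Fin.strictMono_iff_lt_succ.2 fun l => (hte _).trans_lt (hu1 l)
  have htpos : ∀ l, 0 < t l := by
    intro l
    refine Fin.cases (hpos i₀) (fun l => (hpos _).trans (hu1 l)) l
  have ht0 : ∀ l, φ (t l) = 0 := by
    intro l
    refine Fin.cases ?_ (fun l => hu0 l) l
    show φ (p i₀) = 0
    rw [hφ, hx₀, mul_zero]
  obtain ⟨k, hk, rfl⟩ := exists_eq_natCast_of_sum_eq_zero hr hpos hmono hε hB hs he htpos mt ht0
  have := sum_powSlope_eq_zero_of_natCast x htpos mt.injective hk.le ht0 (p (e 0))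
  exact mul_ne_zero hμ (he 0).2 ((hφ (e 0)).symm.trans this)

theorem rootMultiplicity_charpoly_powerLoewner {n : ℕ} {p : Fin n → ℝ} (hpos : ∀ i, 0 < p i)
    (hmono : StrictMono p) {r : ℝ} (hr : 0 < r) {μ : ℝ}
    (h : Module.End.HasEigenvalue (Matrix.toLin' (powerLoewner p r)) μ) (hμ : μ ≠ 0) :
    (powerLoewner p r).charpoly.rootMultiplicity μ = 1 := by
  have hA := powerLoewner_isHermitian p r
  have hroot : (powerLoewner p r).charpoly.IsRoot μ := by
    have := (Module.End.hasEigenvalue_iff_isRoot_charpoly _ _).1 h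
    rwa [Matrix.charpoly_toLin'] at this
  have hge := (Polynomial.rootMultiplicity_pos (Matrix.charpoly_monic (powerLoewner p r)).ne_zero).2
    hroot
  refine le_antisymm ?_ hge
  rw [← Polynomial.count_roots, hA.roots_charpoly_eq_eigenvalues, Multiset.count_map]
  show (Finset.univ.filter fun i => μ = hA.eigenvalues i).card ≤ 1
  refine Finset.card_le_one.2 fun i hi j hj => ?_
  have hi : μ = hA.eigenvalues i := (Finset.mem_filter.1 hi).2
  have hj : μ = hA.eigenvalues j := (Finset.mem_filter.1 hj).2
  by_contra hij
  let i₀ : Fin n := ⟨0, i.pos⟩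
  have hi₀ : ∀ i, i₀ ≤ i := fun i => Nat.zero_le _
  let v : Fin n → ℝ := (hA.eigenvectorBasis i).ofLp
  let w : Fin n → ℝ := (hA.eigenvectorBasis j).ofLp
  have hv : (powerLoewner p r).mulVec v = μ • v := hi ▸ hA.mulVec_eigenvectorBasis i
  have hw : (powerLoewner p r).mulVec w = μ • w := hj ▸ hA.mulVec_eigenvectorBasis j
  have hvw : v ⬝ᵥ w = 0 := by
    have : inner ℝ (hA.eigenvectorBasis i) (hA.eigenvectorBasis j) = 0 :=
      hA.eigenvectorBasis.orthonormal.2 hij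
    rwa [EuclideanSpace.inner_eq_star_dotProduct, star_trivial, dotProduct_comm] at this
  have hw0 : w ≠ 0 := fun h0 =>
    hA.eigenvectorBasis.orthonormal.ne_zero j (WithLp.ofLp_injective 2 h0)
  have hv0 : v i₀ ≠ 0 := fun h0 =>
    hA.eigenvectorBasis.orthonormal.ne_zero i (WithLp.ofLp_injective 2
      (eq_zero_of_mulVec_eq_smul hpos hmono hr hμ hv hi₀ h0))
  -- the combination of the two eigenvectors that vanishes at the first entry
  have hz := eq_zero_of_mulVec_eq_smul hpos hmono hr hμ (x := v i₀ • w - w i₀ • v)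
    (by rw [Matrix.mulVec_sub, Matrix.mulVec_smul, Matrix.mulVec_smul, hv, hw, smul_sub,
          smul_comm μ, smul_comm μ]) hi₀
    (by simp only [Pi.sub_apply, Pi.smul_apply, smul_eq_mul]; ring)
  have h1 : (v i₀ • w - w i₀ • v) ⬝ᵥ w = v i₀ * (w ⬝ᵥ w) := by
    rw [sub_dotProduct, smul_dotProduct, smul_dotProduct, hvw]
    simp
  rw [hz, zero_dotProduct] at h1
  exact mul_ne_zero hv0 (dotProduct_self_pos hw0).ne' h1.symm

theorem theorem1p1 (n : ℕ) (p : Fin n → ℝ) (hpos : ∀ i, 0 < p i) (hmono : StrictMono p)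
    (r : ℝ) (hr : 0 < r) :
    -- singularity
    ((powerLoewner p r).det = 0 ↔ ∃ m : ℕ, 1 ≤ m ∧ m < n ∧ r = (m : ℝ)) ∧
    -- inertia at the integers 1, ..., n
    (∀ k : ℕ, 1 ≤ k → 2 * k ≤ n → r = 2 * (k : ℝ) →
      loewnerInertia p r = (k, n - 2 * k, k)) ∧
    (∀ k : ℕ, 1 ≤ k → 2 * k - 1 ≤ n → r = 2 * (k : ℝ) - 1 →
      loewnerInertia p r = (k, n - (2 * k - 1), k - 1)) ∧
    -- inertia at non-integers below n
    (r < (n : ℝ) → (∀ m : ℤ, r ≠ (m : ℝ)) →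
      (∀ k : ℕ, ⌊r⌋ = 2 * (k : ℤ) → loewnerInertia p r = (n - k, 0, k)) ∧
      (∀ k : ℕ, ⌊r⌋ = 2 * (k : ℤ) - 1 → loewnerInertia p r = (k, 0, n - k))) ∧
    -- inertia beyond n - 1
    ((n : ℝ) - 1 < r → loewnerInertia p r = loewnerInertia p (n : ℝ)) ∧
    -- simplicity of the nonzero eigenvalues
    (∀ μ : ℝ, Module.End.HasEigenvalue (Matrix.toLin' (powerLoewner p r)) μ → μ ≠ 0 →
      (powerLoewner p r).charpoly.rootMultiplicity μ = 1) := by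
  have hp := hmono.injective
  refine ⟨det_powerLoewner_eq_zero_iff hpos hp hr, fun k hk hkn hrk => ?_, fun k hk hkn hrk => ?_,
    fun hrn hrz => ⟨fun k hk => ?_, fun k hk => ?_⟩, fun h => ?_,
    fun μ h hμ => rootMultiplicity_charpoly_powerLoewner hpos hmono hr h hμ⟩
  · exact hermitianInertia_of_le _ (le_signCount_one hk (by omega) hpos hp (by linarith))
      (sub_le_card_zero_eigenvalues hpos hp (by rw [hrk]; push_cast; rfl))
      (le_signCount_neg_one hkn hpos hp (by linarith)) (by omega)
  · have hk1 : ((k - 1 : ℕ) : ℝ) = k - 1 := by rw [Nat.cast_sub hk, Nat.cast_one]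
    refine hermitianInertia_of_le _ (le_signCount_one hk hkn hpos hp (by linarith))
      (sub_le_card_zero_eigenvalues hpos hp ?_)
      (le_signCount_neg_one (by omega) hpos hp (by rw [hk1]; linarith)) (by omega)
    rw [hrk, Nat.cast_sub (by omega)]
    push_cast
    rfl
  · have h1 : 2 * (k : ℝ) ≤ r := by
      have := Int.floor_le r
      rw [hk] at this
      exact_mod_cast this
    have h2 : r < 2 * k + 1 := by
      have := Int.lt_floor_add_one r
      rw [hk] at this
      exact_mod_cast this
    have h3 : 2 * (k : ℝ) < r :=
      lt_of_le_of_ne h1 fun e => hrz (2 * k) (by rw [← e]; push_cast; rfl)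
    have h4 : 2 * k ≤ n := by
      have : 2 * (k : ℝ) < n := h3.trans hrn
      exact_mod_cast this.le
    exact hermitianInertia_of_le _ (sub_le_signCount_one hpos hp h3 h2) (Nat.zero_le _)
      (le_signCount_neg_one h4 hpos hp (by linarith)) (by omega)
  · have h1 : 2 * (k : ℝ) - 1 ≤ r := by
      have := Int.floor_le r
      rw [hk] at this
      exact_mod_cast this
    have h2 : r < 2 * k := by
      have := Int.lt_floor_add_one r
      rw [hk] at this
      push_cast at this
      linarith
    have h3 : 2 * (k : ℝ) - 1 < r :=
      lt_of_le_of_ne h1 fun e => hrz (2 * k - 1) (by rw [← e]; push_cast; rfl)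
    have hk0 : 1 ≤ k := by
      have : (0 : ℝ) < 2 * k := hr.trans h2
      have : 0 < 2 * k := by exact_mod_cast this
      omega
    have h4 : 2 * k ≤ n := by
      have : 2 * (k : ℝ) < n + 1 := by linarith
      have : 2 * k < n + 1 := by exact_mod_cast this
      omega
    exact hermitianInertia_of_le _ (le_signCount_one hk0 (by omega) hpos hp (by linarith))
      (Nat.zero_le _) (sub_le_signCount_neg_one hpos hp h3 h2) (by omega)
  · rw [loewnerInertia_of_lt hpos hp h, loewnerInertia_of_lt hpos hp (sub_one_lt _)]
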